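/- **Setting.** Let agents $0$ (leader) and $1,\dots,N$ (followers) communicate over a digraph; put $a_{ij}=1$ if agent $i$ receives information from agent $j$ and $a_{ij}=0$ otherwise, and assume that every follower is reachable from the leader by a directed path (along the direction of information flow). The input delays $\tau_{u_i}$ are differentiable on $[0,\infty)$ with $0\le\tau_{u_i}(t)\le\bar\tau$ and $\dot\tau_{u_i}(t)\le\hat\tau$; the communication delays $\tau_{c_{ij}}$ (from $j$ to $i$) are measurable with $0\le\tau_{c_{ij}}(t)\le\bar\tau_c$ for some constant $\bar\tau_c$. Fix $\bar\tau\ge0$, $\hat\tau\ge0$, $\delta>0$, $\gamma>0$, $\varepsilon\in\mathbb R$ and an observer gain $\epsilon>0$. Differential equations hold for almost every $t\ge0$, with locally absolutely continuous solutions. For $A\in\mathbb R^{n\times n}$, $B\in\mathbb R^{n\times p}$ say that $(\bar P,\bar Q,\bar R,\bar S,\bar S_{12},M,Y)$, with $Y\in\mathbb R^{p\times n}$ and the other matrices in $\mathbb R^{n\times n}$, solves $\mathrm{LMI}(A,B)$ if $\bar P,\bar R,\bar S\succ0$, $\bar Q\succ0$ when $\hat\tau<1$ and $\bar Q=0$ when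 $\hat\tau\ge1$, and $$\Phi_2=\begin{bmatrix}\Phi_{11}&\Phi_{12}&e^{-2\delta\bar\tau}\bar S_{12}&\Phi_{14}&I_n\\ *&\Phi_{22}&0&\varepsilon BY&\varepsilon I_n\\ *&*&\Phi_{33}&\Phi_{34}&0\\ *&*&*&\Phi_{44}&0\\ *&*&*&*&-\gamma I_n\end{bmatrix}\prec0,\qquad \Phi_2'=\begin{bmatrix}\bar R&\bar S_{12}\\ *&\bar R\end{bmatrix}\succeq0,$$ where $*$ denotes the symmetric blocks and $\Phi_{11}=2\delta\bar P+\bar S+\bar Q-e^{-2\delta\bar\tau}\bar R+AM+M^TA^T$, $\Phi_{12}=\bar P-M+\varepsilon M^TA^T$, $\Phi_{14}=BY+e^{-2\delta\bar\tau}(\bar R-\bar S_{12})$, $\Phi_{22}=\bar\tau^2\bar R-\varepsilon M^T-\varepsilon M$, $\Phi_{33}=-e^{-2\delta\bar\tau}(\bar S+\bar R)$, $\Phi_{34}=e^{-2\delta\bar\tau}(\bar R-\bar S_{12}^T)$, $\Phi_{44}=-(1-\hat\tau)e^{-2\delta\bar\tau}\bar Q+e^{-2\delta\bar\tau}(-2\bar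 R+\bar S_{12}+\bar S_{12}^T)$. Write $P=M^{-T}\bar PM^{-1}$. For a leader matrix $A_0$, the observers are $\xi_i(t)=0$ for $t\le0$ and $$\dot\xi_i(t)=A_0\xi_i(t)+\epsilon\sum_{j\in\{1,\dots,N\},\,j\ne i}a_{ij}\bigl[e^{A_0\tau_{c_{ij}}(t)}\xi_j(t-\tau_{c_{ij}}(t))-\xi_i(t)\bigr]+\epsilon a_{i0}\bigl[e^{A_0\tau_{c_{i0}}(t)}x_0(t-\tau_{c_{i0}}(t))-\xi_i(t)\bigr].$$ The initial data are $x_i(0)$, the values of $u_i$ on $[-\bar\tau,0)$ and of $x_0$ on $[-\bar\tau_c,0]$; $D$ denotes any bound for the norms of all of them. **I (homogeneous agents).** Consider $\dot x_0=Ax_0$ and $\dot x_i(t)=Ax_i(t)+Bu_i(t-\tau_{u_i}(t))+v_i(t)$, where $A$ has no eigenvalue with positive real part. Suppose that $(\bar P,\dots,M,Y)$ solves $\mathrm{LMI}(A,B)$ and apply $u_i(t)=K(x_i(t)-\xi_i(t))$, $t\ge0$, with $K=YM^{-1}$ and the observer with $A_0=A$. Then the tracking errors $\tilde x_i=x_i-x_0$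 satisfy: (a) there are $c,\kappa>0$, independent of the initial data, such that $\|\tilde x_i(t)\|\le cDe^{-\kappa t}$ for all $t\ge0$ whenever $v_i\equiv0$; (b) there is $c>0$, independent of the initial data and of the disturbances, such that $\|\tilde x_i(t)\|\le c(D+\Delta_i)$ for all $t\ge0$ whenever $v_i\in L_\infty[0,\infty)$ with $\|v_i\|_\infty\le\Delta_i$; (c) in the situation of (b), $\limsup_{t\to\infty}\|\tilde x_i(t)\|^2\le\frac{\gamma}{2\delta\lambda_{\min}(P)}\Delta_i^2$. **II (heterogeneous agents).** Consider $\dot x_0=A_0x_0$, $y_0=C_0x_0$ and $\dot x_i(t)=A_ix_i(t)+B_iu_i(t-\tau_{u_i}(t))+v_i(t)$, $y_i=C_ix_i$, with $x_i(t)\in\mathbb R^{n_i}$, $u_i(t)\in\mathbb R^{p_i}$, where every eigenvalue of $A_0$ has negative real part, or has zero real part and is simple. Let $(X_i,U_i)$ satisfy $X_iA_0=A_iX_i+B_iU_i$ and $C_0=C_iX_i$, let $(\bar P_i,\dots,M_i,Y_i)$ solve $\mathrm{LMI}(A_i,B_i)$ for each $i$, put $P_i=M_i^{-T}\bar P_iM_i^{-1}$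 and $K_i^1=Y_iM_i^{-1}$, and apply $u_i(t)=K_i^1x_i(t)-K_i^2\xi_i(t)$, $t\ge0$. Then the output consensus errors $\tilde x_i=y_i-y_0$ satisfy: (a) both if $K_i^2=K_i^1X_i-U_i$ for all $i$ and if $K_i^2=U_i-K_i^1X_i$ for all $i$, there is $c>0$, independent of the initial data and of the disturbances, such that $\|\tilde x_i(t)\|\le c(D+\Delta_i)$ for all $t\ge0$ whenever $\|v_i\|_\infty\le\Delta_i$; (b) if $K_i^2=K_i^1X_i-U_i$ for all $i$, $\|v_i\|_\infty\le\Delta_i$, and $\|B_iU_i(x_0(t)-x_0(t-\tau_{u_i}(t)))\|\le\beta$ for all large $t$, then $\limsup_{t\to\infty}\|\tilde x_i(t)\|^2\le\frac{\gamma\|C_i\|^2}{2\delta\lambda_{\min}(P_i)}(\Delta_i+\beta)^2$. -/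

import Mathlib

open MeasureTheory Filter Topology

noncomputable section

namespace DelayMAS

/-- `ℝⁿ` with the Euclidean norm. -/
abbrev E (n : ℕ) : Type := EuclideanSpace ℝ (Fin n)

/-! ### Solutions and disturbances -/

/-- Carathéodory solution of `ẋ(t) = f(t)` on `[0, ∞)`: `f` is locally integrable and `x` is its
primitive, i.e. `x` is locally absolutely continuous and `ẋ = f` almost everywhere. -/
def IsSolution {n : ℕ} (x f : ℝ → E n) : Prop :=
  ∀ t : ℝ, 0 ≤ t → IntervalIntegrable f volume 0 t ∧ x t = x 0 + ∫ s in (0 : ℝ)..t, f s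

/-- `v ∈ L_∞[0, ∞)` with `‖v‖_∞ ≤ Δ`. -/
def EssBoundedBy {n : ℕ} (v : ℝ → E n) (Δ : ℝ) : Prop :=
  AEStronglyMeasurable v (volume.restrict (Set.Ici 0)) ∧
    ∀ᵐ t ∂(volume.restrict (Set.Ici (0 : ℝ))), ‖v t‖ ≤ Δ

/-! ### Communication graph

The agents are the vertices of a digraph on `Fin (N + 1)`: the vertex `0` is the leader and
`i.succ` is the follower `i : Fin N`. `G.Adj j i` is an edge from `j` to `i` along which
information flows, that is, agent `i` receives information from agent `j`. -/

/-- The weight `a_{ij}`: it is `1` if agent `i` receives information from agent `j`, else `0`. -/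
def weight {N : ℕ} (G : Digraph (Fin (N + 1))) (i j : Fin (N + 1)) : ℝ :=
  open Classical in if G.Adj j i then 1 else 0

/-- `G` contains a directed spanning tree whose root is the leader. -/
def LeaderRooted {N : ℕ} (G : Digraph (Fin (N + 1))) : Prop :=
  ∀ i : Fin (N + 1), Relation.ReflTransGen G.Adj 0 i

/-! ### Delays -/

/-- Input delays: differentiable, `0 ≤ τ_{u_i} ≤ τbar` and `τ̇_{u_i} ≤ τhat` on `[0, ∞)`. -/
structure InputDelays {N : ℕ} (τbar τhat : ℝ) (τu : Fin N → ℝ → ℝ) : Prop where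
  nonneg : ∀ i t, 0 ≤ t → 0 ≤ τu i t
  le_bar : ∀ i t, 0 ≤ t → τu i t ≤ τbar
  differentiable : ∀ i, DifferentiableOn ℝ (τu i) (Set.Ici 0)
  deriv_le : ∀ i t, 0 ≤ t → derivWithin (τu i) (Set.Ici 0) t ≤ τhat

/-- Communication delays: `τc i j` is the delay from agent `j` to follower `i`. Along the edges
of the graph the delays are measurable and take values in `[0, τcbar]`. -/
structure CommDelays {N : ℕ} (G : Digraph (Fin (N + 1))) (τcbar : ℝ)
    (τc : Fin N → Fin (N + 1) → ℝ → ℝ) : Prop where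
  measurable : ∀ i j, G.Adj j i.succ → Measurable (τc i j)
  nonneg : ∀ i j t, G.Adj j i.succ → 0 ≤ t → 0 ≤ τc i j t
  le_bar : ∀ i j t, G.Adj j i.succ → 0 ≤ t → τc i j t ≤ τcbar

/-! ### Spectral notions -/

/-- No eigenvalue of `A` has positive real part. -/
def NoUnstableEigenvalue {n : ℕ} (A : Matrix (Fin n) (Fin n) ℝ) : Prop :=
  ∀ μ ∈ spectrum ℂ (A.map (algebraMap ℝ ℂ)), μ.re ≤ 0

/-- Every eigenvalue of `A` has negative real part, or has zero real part and is simple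
(algebraic multiplicity one). -/
def MarginallyStable {n : ℕ} (A : Matrix (Fin n) (Fin n) ℝ) : Prop :=
  ∀ μ ∈ spectrum ℂ (A.map (algebraMap ℝ ℂ)),
    μ.re < 0 ∨ (μ.re = 0 ∧ (A.map (algebraMap ℝ ℂ)).charpoly.rootMultiplicity μ = 1)

/-- The smallest eigenvalue of a symmetric matrix. -/
def lambdaMin {n : ℕ} (P : Matrix (Fin n) (Fin n) ℝ) : ℝ := sInf (spectrum ℝ P)

/-- The norm of a matrix induced by the Euclidean norms. -/
def opNorm {m n : ℕ} (C : Matrix (Fin m) (Fin n) ℝ) : ℝ :=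
  ‖LinearMap.toContinuousLinearMap C.toEuclideanLin‖

/-! ### Observer and closed-loop systems -/

/-- Right-hand side of the observer of follower `i`, for the leader matrix `A₀`:
`A₀ ξ_i(t) + ϵ ∑_{j ≠ i} a_{ij} [e^{A₀ τ_{ij}(t)} ξ_j(t - τ_{ij}(t)) - ξ_i(t)]`
`  + ϵ a_{i0} [e^{A₀ τ_{i0}(t)} x₀(t - τ_{i0}(t)) - ξ_i(t)]`, the sum being over followers `j`. -/
def observerRHS {N n : ℕ} (G : Digraph (Fin (N + 1))) (ϵ : ℝ)
    (τc : Fin N → Fin (N + 1) → ℝ → ℝ) (A₀ : Matrix (Fin n) (Fin n) ℝ)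
    (x₀ : ℝ → E n) (ξ : Fin N → ℝ → E n) (i : Fin N) (t : ℝ) : E n :=
  A₀.toEuclideanLin (ξ i t)
    + ϵ • ∑ j ∈ Finset.univ.erase i, weight G i.succ j.succ •
        ((NormedSpace.exp (τc i j.succ t • A₀)).toEuclideanLin (ξ j (t - τc i j.succ t)) - ξ i t)
    + (ϵ * weight G i.succ 0) •
        ((NormedSpace.exp (τc i 0 t • A₀)).toEuclideanLin (x₀ (t - τc i 0 t)) - ξ i t)

/-- Trajectory of the homogeneous multi-agent system with the observer and the input
`u_i = K (x_i - ξ_i)`. The values of `u_i` and `x₀` at negative times are initial data. -/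
structure HomClosedLoop {N n p : ℕ} (G : Digraph (Fin (N + 1))) (ϵ : ℝ)
    (τu : Fin N → ℝ → ℝ) (τc : Fin N → Fin (N + 1) → ℝ → ℝ)
    (A : Matrix (Fin n) (Fin n) ℝ) (B : Matrix (Fin n) (Fin p) ℝ) (K : Matrix (Fin p) (Fin n) ℝ)
    (v : Fin N → ℝ → E n) (x₀ : ℝ → E n) (x ξ : Fin N → ℝ → E n) (u : Fin N → ℝ → E p) :
    Prop where
  leader : IsSolution x₀ fun t => A.toEuclideanLin (x₀ t)
  follower : ∀ i, IsSolution (x i) fun t =>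
    A.toEuclideanLin (x i t) + B.toEuclideanLin (u i (t - τu i t)) + v i t
  observer_init : ∀ i t, t ≤ 0 → ξ i t = 0
  observer : ∀ i, IsSolution (ξ i) (observerRHS G ϵ τc A x₀ ξ i)
  input : ∀ i t, 0 ≤ t → u i t = K.toEuclideanLin (x i t - ξ i t)

/-- Trajectory of the heterogeneous multi-agent system with the observer and the input
`u_i = K¹_i x_i - K²_i ξ_i`. The values of `u_i` and `x₀` at negative times are initial data. -/
structure HetClosedLoop {N n : ℕ} {nn pp : Fin N → ℕ} (G : Digraph (Fin (N + 1))) (ϵ : ℝ)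
    (τu : Fin N → ℝ → ℝ) (τc : Fin N → Fin (N + 1) → ℝ → ℝ)
    (A₀ : Matrix (Fin n) (Fin n) ℝ)
    (A : ∀ i, Matrix (Fin (nn i)) (Fin (nn i)) ℝ) (B : ∀ i, Matrix (Fin (nn i)) (Fin (pp i)) ℝ)
    (K₁ : ∀ i, Matrix (Fin (pp i)) (Fin (nn i)) ℝ) (K₂ : ∀ i, Matrix (Fin (pp i)) (Fin n) ℝ)
    (v : ∀ i, ℝ → E (nn i)) (x₀ : ℝ → E n) (x : ∀ i, ℝ → E (nn i)) (ξ : Fin N → ℝ → E n)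
    (u : ∀ i, ℝ → E (pp i)) : Prop where
  leader : IsSolution x₀ fun t => A₀.toEuclideanLin (x₀ t)
  follower : ∀ i, IsSolution (x i) fun t =>
    (A i).toEuclideanLin (x i t) + (B i).toEuclideanLin (u i (t - τu i t)) + v i t
  observer_init : ∀ i t, t ≤ 0 → ξ i t = 0
  observer : ∀ i, IsSolution (ξ i) (observerRHS G ϵ τc A₀ x₀ ξ i)
  input : ∀ i t, 0 ≤ t →
    u i t = (K₁ i).toEuclideanLin (x i t) - (K₂ i).toEuclideanLin (ξ i t)

/-- All initial data have size at most `D`: the initial states of the followers, the inputs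
applied before time `0`, and the leader state up to time `0` (as far as the delays reach back). -/
structure InitialDataBound {N n : ℕ} {nn pp : Fin N → ℕ} (τbar τcbar : ℝ) (x₀ : ℝ → E n)
    (x : ∀ i, ℝ → E (nn i)) (u : ∀ i, ℝ → E (pp i)) (D : ℝ) : Prop where
  state : ∀ i, ‖x i 0‖ ≤ D
  input : ∀ i, ∀ s ∈ Set.Ico (-τbar) 0, ‖u i s‖ ≤ D
  leader : ∀ s ∈ Set.Icc (-τcbar) 0, ‖x₀ s‖ ≤ D

/-! ### The linear matrix inequalities -/

section LMI

variable {n p : ℕ}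

/-- The symmetric `5 × 5` block matrix `Φ₂`. -/
def Phi2 (A : Matrix (Fin n) (Fin n) ℝ) (B : Matrix (Fin n) (Fin p) ℝ) (τbar τhat δ γ ε : ℝ)
    (P Q R S S₁₂ M : Matrix (Fin n) (Fin n) ℝ) (Y : Matrix (Fin p) (Fin n) ℝ) :
    Matrix (Fin 5 × Fin n) (Fin 5 × Fin n) ℝ :=
  let e : ℝ := Real.exp (-2 * δ * τbar)
  let Φ11 := (2 * δ) • P + S + Q - e • R + A * M + M.transpose * A.transpose
  let Φ12 := P - M + ε • (M.transpose * A.transpose)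
  let Φ13 := e • S₁₂
  let Φ14 := B * Y + e • (R - S₁₂)
  let Φ22 := τbar ^ 2 • R - ε • M.transpose - ε • M
  let Φ24 := ε • (B * Y)
  let Φ33 := -(e • (S + R))
  let Φ34 := e • (R - S₁₂.transpose)
  let Φ44 := -(((1 - τhat) * e) • Q) + e • (-((2 : ℝ) • R) + S₁₂ + S₁₂.transpose)
  let I : Matrix (Fin n) (Fin n) ℝ := 1
  Matrix.comp (Fin 5) (Fin 5) (Fin n) (Fin n) ℝ
    !![Φ11,           Φ12,           Φ13,           Φ14,   I;
       Φ12.transpose, Φ22,           0,             Φ24,   ε • I;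
       Φ13.transpose, 0,             Φ33,           Φ34,   0;
       Φ14.transpose, Φ24.transpose, Φ34.transpose, Φ44,   0;
       I,             ε • I,         0,             0,     -(γ • I)]

/-- The block matrix `Φ₂' = [R, S₁₂; S₁₂ᵀ, R]`. -/
def Phi2' (R S₁₂ : Matrix (Fin n) (Fin n) ℝ) : Matrix (Fin n ⊕ Fin n) (Fin n ⊕ Fin n) ℝ :=
  Matrix.fromBlocks R S₁₂ S₁₂.transpose R

/-- `(P, Q, R, S, S₁₂, M, Y)` is a solution of the linear matrix inequalities `Φ₂ ≺ 0` and
`Φ₂' ⪰ 0` with `P, R, S ≻ 0`, and `Q ≻ 0` if `τhat < 1`, `Q = 0` if `τhat ≥ 1`. -/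
structure LMISolution (A : Matrix (Fin n) (Fin n) ℝ) (B : Matrix (Fin n) (Fin p) ℝ)
    (τbar τhat δ γ ε : ℝ) (P Q R S S₁₂ M : Matrix (Fin n) (Fin n) ℝ)
    (Y : Matrix (Fin p) (Fin n) ℝ) : Prop where
  posDef_P : P.PosDef
  posDef_R : R.PosDef
  posDef_S : S.PosDef
  posDef_Q : τhat < 1 → Q.PosDef
  zero_Q : 1 ≤ τhat → Q = 0
  phi2_neg : (-(Phi2 A B τbar τhat δ γ ε P Q R S S₁₂ M Y)).PosDef
  phi2'_nonneg : (Phi2' R S₁₂).PosSemidef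

end LMI

/-- The matrix `M⁻ᵀ P M⁻¹`. -/
def unbar {n : ℕ} (P M : Matrix (Fin n) (Fin n) ℝ) : Matrix (Fin n) (Fin n) ℝ :=
  M⁻¹.transpose * P * M⁻¹

end DelayMAS

end

noncomputable section

namespace DelayMAS

/-! The closed loop is a cascade: the observers form an autonomous network driven by the leader, and
each follower is a linear system with one delay, perturbed by its observer error and by `v`.

Observers. In the moving frame `d_j(t) = e^{-tA} ξ_j(t) - x₀(0)` (for the leader, `d_0(t) = e^{-tA}
x₀(t) - x₀(0)`) the factors `e^{A τ}` exactly cancel the communication delays, and what remains is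
the scalar-weighted consensus equation `ḋ_i = ϵ ∑ a_ij (d_j(t - τ_ij) - d_i)` with `d_0 = 0` on `[0,
∞)`. Since every follower is reachable from the leader, there are weights `m_j` with `∑ a_ij m_j <
(∑ a_ij) m_i`; by continuity `m_j e^{-κ t}` is a supersolution for small `κ > 0`, delays included,
and a maximum argument (`norm_le_of_supersolution`) gives exponential decay of `d`. Returning to the
original frame costs a factor `e^{κ t / 2}`, because `A` has no unstable eigenvalue
(`exists_observer_error_bound`).

Followers. With `z = M η`, the error satisfies `M η̇ = A M η + B Y η(t - τ) + w`. The form of `Φ₂`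
at `(η, η̇, η(t - τbar), η(t - τ), w)` is the derivative estimate of a Lyapunov-Krasovskii
functional plus multiples of this equation (descriptor method); the double-integral term is handled
by Jensen's inequality and by the reciprocally convex bound coming from `Φ₂'`. The result is `V(t) ≤
e^{-2δ(t-s)} V(s) + γ/(2δ) a²` whenever `‖w‖ ≤ a` on `[s, t]` (`LMISolution.exists_functional`),
which yields boundedness, exponential decay and the ultimate bound.

Initial inputs. The error is continued to negative times by the constant `z(0)`, and the discrepancy
with the actual past input is charged to `w`; it occurs only while `t < τbar`. In the homogeneous
case `w` is then `v` plus an exponentially decaying term (`exists_tracking_disturbance`). In the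
heterogeneous case `z = x_i - X_i x₀`, and `w` also contains terms in `x₀`, which is bounded by
marginal stability; with `K₂ = K₁ X - U` these combine to `B U (x₀(t) - x₀(t - τ))`, the quantity
bounded by `β` (`exists_regulation_disturbance`). -/

/-- `x` is a primitive of the locally integrable function `f` on `[0, ∞)`. -/
def IsPrimitive {F : Type*} [NormedAddCommGroup F] [NormedSpace ℝ F] (x f : ℝ → F) : Prop :=
  ∀ t : ℝ, 0 ≤ t → IntervalIntegrable f volume 0 t ∧ x t = x 0 + ∫ s in (0 : ℝ)..t, f s

theorem IsSolution.isPrimitive {n : ℕ} {x f : ℝ → E n} (h : IsSolution x f) : IsPrimitive x f := h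

/-! ### Calculus of locally absolutely continuous functions on `[0, ∞)`. -/

namespace IsPrimitive

variable {F G H : Type*} [NormedAddCommGroup F] [NormedSpace ℝ F]
  [NormedAddCommGroup G] [NormedSpace ℝ G] [NormedAddCommGroup H] [NormedSpace ℝ H]
  {x y f g : ℝ → F}

theorem intervalIntegrable (h : IsPrimitive x f) {s t : ℝ} (hs : 0 ≤ s) (ht : 0 ≤ t) :
    IntervalIntegrable f volume s t :=
  (h s hs).1.symm.trans (h t ht).1

theorem sub_eq (h : IsPrimitive x f) {s t : ℝ} (hs : 0 ≤ s) (ht : 0 ≤ t) :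
    x t - x s = ∫ r in s..t, f r := by
  rw [(h s hs).2, (h t ht).2, add_sub_add_left_eq_sub,
    intervalIntegral.integral_interval_sub_left (h t ht).1 (h s hs).1]

theorem congr (h : IsPrimitive x f) (hx : ∀ t, 0 ≤ t → x t = y t)
    (hf : ∀ᵐ t ∂(volume.restrict (Set.Ici (0 : ℝ))), f t = g t) : IsPrimitive y g := by
  intro t ht
  have hsub : Set.uIoc 0 t ⊆ Set.Ici 0 := by
    rw [Set.uIoc_of_le ht]
    exact fun s hs => hs.1.le
  have hae : f =ᵐ[volume.restrict (Set.uIoc 0 t)] g := ae_restrict_of_ae_restrict_of_subset hsub hf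
  refine ⟨(h t ht).1.congr_ae hae, ?_⟩
  rw [← hx t ht, ← hx 0 le_rfl, (h t ht).2, intervalIntegral.integral_congr_ae_restrict hae]

theorem congr_right (h : IsPrimitive x f) (hf : ∀ t, 0 ≤ t → f t = g t) : IsPrimitive x g :=
  h.congr (fun _ _ => rfl) ((ae_restrict_mem measurableSet_Ici).mono fun t ht => hf t ht)

theorem continuousOn (h : IsPrimitive x f) : ContinuousOn x (Set.Ici 0) := by
  intro t ht
  have ht : (0 : ℝ) ≤ t := ht
  have h1 : ContinuousOn (fun t => x 0 + ∫ s in (0 : ℝ)..t, f s) (Set.uIcc 0 (t + 1)) :=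
    continuousOn_const.add (intervalIntegral.continuousOn_primitive_interval'
      (h (t + 1) (by linarith)).1 Set.left_mem_uIcc)
  rw [Set.uIcc_of_le (by linarith)] at h1
  have h2 : ContinuousOn x (Set.Icc 0 (t + 1)) := h1.congr fun s hs => (h s hs.1).2
  refine (h2 t ⟨ht, by linarith⟩).mono_of_mem_nhdsWithin ?_
  rw [mem_nhdsWithin]
  exact ⟨Set.Iio (t + 1), isOpen_Iio, by simp, fun s hs => ⟨hs.2, le_of_lt hs.1⟩⟩

theorem add (hx : IsPrimitive x f) (hy : IsPrimitive y g) :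
    IsPrimitive (fun t => x t + y t) (fun t => f t + g t) := by
  intro t ht
  refine ⟨(hx t ht).1.add (hy t ht).1, ?_⟩
  rw [intervalIntegral.integral_add (hx t ht).1 (hy t ht).1]
  simp only
  rw [(hx t ht).2, (hy t ht).2]
  abel

theorem map [CompleteSpace F] [CompleteSpace G] (L : F →L[ℝ] G) (hx : IsPrimitive x f) :
    IsPrimitive (fun t => L (x t)) (fun t => L (f t)) := by
  intro t ht
  refine ⟨⟨L.integrable_comp (hx t ht).1.1, L.integrable_comp (hx t ht).1.2⟩, ?_⟩
  simp only
  rw [L.intervalIntegral_comp_comm (hx t ht).1, ← map_add, ← (hx t ht).2]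

theorem neg [CompleteSpace F] (hx : IsPrimitive x f) : IsPrimitive (fun t => -x t) (fun t => -f t) := by
  simpa using hx.map (-(ContinuousLinearMap.id ℝ F))

theorem sub [CompleteSpace F] (hx : IsPrimitive x f) (hy : IsPrimitive y g) :
    IsPrimitive (fun t => x t - y t) (fun t => f t - g t) := by
  simpa only [sub_eq_add_neg] using hx.add hy.neg

theorem const (c : F) : IsPrimitive (fun _ => c) (fun _ => 0) := by
  intro t _
  simp

theorem sum {ι : Type*} (s : Finset ι) {X Y : ι → ℝ → F} (h : ∀ i ∈ s, IsPrimitive (X i) (Y i)) :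
    IsPrimitive (fun t => ∑ i ∈ s, X i t) (fun t => ∑ i ∈ s, Y i t) := by
  classical
  induction s using Finset.induction_on with
  | empty => simpa using const (0 : F)
  | insert a s ha ih =>
    simp only [Finset.sum_insert ha]
    exact (h a (by simp)).add (ih fun i hi => h i (by simp [hi]))

theorem of_hasDerivAt [CompleteSpace F] (h : ∀ t, HasDerivAt x (f t) t) (hf : Continuous f) :
    IsPrimitive x f := by
  intro t _
  refine ⟨hf.intervalIntegrable _ _, ?_⟩
  rw [intervalIntegral.integral_eq_sub_of_hasDerivAt (fun s _ => h s) (hf.intervalIntegrable _ _)]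
  abel

theorem mul {x f y g : ℝ → ℝ} (hx : IsPrimitive x f) (hy : IsPrimitive y g) :
    IsPrimitive (fun t => x t * y t) (fun t => f t * y t + x t * g t) := by
  intro t ht
  have hcx : ContinuousOn x (Set.uIcc 0 t) := by
    rw [Set.uIcc_of_le ht]; exact hx.continuousOn.mono fun s hs => hs.1
  have hcy : ContinuousOn y (Set.uIcc 0 t) := by
    rw [Set.uIcc_of_le ht]; exact hy.continuousOn.mono fun s hs => hs.1
  refine ⟨((hx t ht).1.mul_continuousOn hcy).add ((hy t ht).1.continuousOn_mul hcx), ?_⟩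
  have key : ∀ {a b : ℝ → ℝ}, IsPrimitive a b →
      ∃ a' : ℝ → ℝ, AbsolutelyContinuousOnInterval a' 0 t ∧ (∀ s ∈ Set.Icc 0 t, a' s = a s) ∧
        ∀ᵐ s, s ∈ Set.uIoc 0 t → deriv a' s = b s := by
    intro a b hab
    -- Two-sided derivatives are needed, while `a` is controlled only on `[0, ∞)`; the integral
    -- formula defines a substitute that agrees with `a` on `[0, t]`.
    refine ⟨fun s => (∫ r in (0 : ℝ)..s, b r) + a 0, ?_, ?_, ?_⟩
    · exact ((hab t ht).1.absolutelyContinuousOnInterval_intervalIntegral Set.left_mem_uIcc).add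
        (LipschitzOnWith.absolutelyContinuousOnInterval (K := 0)
          (LipschitzWith.const (a 0)).lipschitzOnWith)
    · intro s hs
      simp only [(hab s hs.1).2]
      ring
    · filter_upwards [(hab t ht).1.ae_hasDerivAt_integral] with s hs hst
      exact ((hs (Set.uIoc_subset_uIcc hst) 0 Set.left_mem_uIcc).add_const _).deriv
  obtain ⟨x', hx1, hx2, hx3⟩ := key hx
  obtain ⟨y', hy1, hy2, hy3⟩ := key hy
  have h := hx1.integral_deriv_mul_eq_sub hy1
  rw [hx2 t ⟨ht, le_rfl⟩, hx2 0 ⟨le_rfl, ht⟩, hy2 t ⟨ht, le_rfl⟩, hy2 0 ⟨le_rfl, ht⟩] at h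
  have h2 : ∫ s in (0 : ℝ)..t, (f s * y s + x s * g s)
      = ∫ s in (0 : ℝ)..t, (deriv x' s * y' s + x' s * deriv y' s) := by
    apply intervalIntegral.integral_congr_ae
    filter_upwards [hx3, hy3] with s h1 h2 hs
    have hs' : s ∈ Set.Icc 0 t := by
      rw [Set.uIoc_of_le ht] at hs; exact ⟨hs.1.le, hs.2⟩
    rw [h1 hs, h2 hs, hx2 s hs', hy2 s hs']
  rw [h2, h]
  ring

/-- Product rule for continuous bilinear maps between finite-dimensional spaces. -/
theorem bilin [FiniteDimensional ℝ F] [FiniteDimensional ℝ G] [CompleteSpace H]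
    (B : F →L[ℝ] G →L[ℝ] H)
    {y g : ℝ → G} (hx : IsPrimitive x f) (hy : IsPrimitive y g) :
    IsPrimitive (fun t => B (x t) (y t)) (fun t => B (f t) (y t) + B (x t) (g t)) := by
  let b := Module.finBasis ℝ F
  let b' := Module.finBasis ℝ G
  have : CompleteSpace F := FiniteDimensional.complete ℝ F
  have : CompleteSpace G := FiniteDimensional.complete ℝ G
  -- In coordinates the claim becomes a finite sum of scalar product rules.
  have expand : ∀ u w, B u w = ∑ i, ∑ j, (b.repr u i * b'.repr w j) • B (b i) (b' j) := by
    intro u w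
    conv_lhs => rw [← b.sum_repr u, ← b'.sum_repr w]
    simp only [map_sum, map_smul, sum_apply, smul_apply,
      smul_smul, Finset.smul_sum]
    refine Finset.sum_comm.trans (Finset.sum_congr rfl fun i _ => Finset.sum_congr rfl fun j _ => ?_)
    rw [mul_comm]
  have hX : ∀ i, IsPrimitive (fun t => b.repr (x t) i) (fun t => b.repr (f t) i) := fun i =>
    hx.map (LinearMap.toContinuousLinearMap (b.coord i))
  have hY : ∀ j, IsPrimitive (fun t => b'.repr (y t) j) (fun t => b'.repr (g t) j) := fun j =>
    hy.map (LinearMap.toContinuousLinearMap (b'.coord j))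
  have h := IsPrimitive.sum Finset.univ fun i _ => IsPrimitive.sum Finset.univ fun j _ =>
    ((hX i).mul (hY j)).map (ContinuousLinearMap.toSpanSingleton ℝ (B (b i) (b' j)))
  refine (h.congr (fun t _ => ?_) (Eventually.of_forall fun t => ?_))
  · simp [expand (x t) (y t)]
  · simp only [ContinuousLinearMap.toSpanSingleton_apply, expand (x t) (g t), expand (f t) (y t),
      add_smul, Finset.sum_add_distrib]

end IsPrimitive

/-! ### Growth of complex matrix exponentials. -/

section ComplexGrowth

variable {n : ℕ}

/-- A vector annihilated by a power of `T - μ` grows at most like `e^{κ t}`, for every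
`κ > Re μ`. -/
theorem exists_norm_exp_smul_apply_le
    (T : EuclideanSpace ℂ (Fin n) →L[ℂ] EuclideanSpace ℂ (Fin n))
    (μ : ℂ) {κ : ℝ} (hκ : μ.re < κ) (k : ℕ) (v : EuclideanSpace ℂ (Fin n))
    (hv : ((T - μ • 1) ^ k) v = 0) :
    ∃ c : ℝ, 0 ≤ c ∧ ∀ t : ℝ, 0 ≤ t → ‖NormedSpace.exp (t • T) v‖ ≤ c * Real.exp (κ * t) := by
  induction k generalizing v with
  | zero =>
    have : v = 0 := by simpa using hv
    exact ⟨0, le_rfl, fun t _ => by simp [this]⟩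
  | succ k ih =>
    obtain ⟨c, hc, hb⟩ := ih ((T - μ • 1) v) (by simpa [pow_succ] using hv)
    have hpos : 0 < κ - μ.re := by linarith
    refine ⟨‖v‖ + c / (κ - μ.re), by positivity, fun t ht => ?_⟩
    have hz : (0 : ℝ) • T = 0 := zero_smul ℝ T
    -- Differentiating `e^{-sμ} e^{sT} v` replaces `v` by `(T - μ) v`, which needs one power less to
    -- be annihilated. The induction hypothesis bounds the derivative by `c e^{(κ - Re μ) s}`, whose
    -- integral is at most `c / (κ - Re μ)` times the same exponential.
    have hd : ∀ s : ℝ, HasDerivAt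
        (fun s : ℝ => Complex.exp (-(s : ℂ) * μ) • NormedSpace.exp (s • T) v)
        (Complex.exp (-(s : ℂ) * μ) • NormedSpace.exp (s • T) ((T - μ • 1) v)) s := by
      intro s
      have h1 : HasDerivAt (fun s : ℝ => NormedSpace.exp (s • T) v)
          (NormedSpace.exp (s • T) (T v)) s := by
        have := (hasDerivAt_exp_smul_const T s)
        exact ((ContinuousLinearMap.apply ℂ _ v).restrictScalars ℝ).hasFDerivAt.comp_hasDerivAt s this
      have h2 : HasDerivAt (fun s : ℝ => Complex.exp (-(s : ℂ) * μ))
          (Complex.exp (-(s : ℂ) * μ) * (-1 * μ)) s :=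
        ((Complex.ofRealCLM.hasDerivAt (x := s)).neg.mul_const μ).cexp
      convert! h2.smul h1 using 1
      simp only [sub_apply, smul_apply, one_apply_eq_self, map_sub, map_smul, smul_sub, smul_smul]
      rw [sub_eq_add_neg, ← neg_smul]
      congr 2
      ring
    have hn : ∀ s : ℝ, ‖Complex.exp (-(s : ℂ) * μ)‖ = Real.exp (-s * μ.re) := by
      intro s
      rw [Complex.norm_exp]
      simp
    have hB : ∀ s : ℝ, HasDerivAt
        (fun s : ℝ => ‖v‖ + c / (κ - μ.re) * Real.exp ((κ - μ.re) * s))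
        (c * Real.exp ((κ - μ.re) * s)) s := by
      intro s
      have := (((hasDerivAt_id s).const_mul (κ - μ.re)).exp.const_mul (c / (κ - μ.re))).const_add ‖v‖
      convert! this using 1
      field_simp
      simp
    have key := image_norm_le_of_norm_deriv_right_le_deriv_boundary (a := 0) (b := t)
      (fun s _ => (hd s).continuousAt.continuousWithinAt) (fun s _ => (hd s).hasDerivWithinAt)
      (B := fun s : ℝ => ‖v‖ + c / (κ - μ.re) * Real.exp ((κ - μ.re) * s))
      (B' := fun s => c * Real.exp ((κ - μ.re) * s)) (by
        rw [hz]
        simpa using div_nonneg hc hpos.le) hB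
      (fun s hs => by
        rw [norm_smul, hn]
        calc _ ≤ Real.exp (-s * μ.re) * (c * Real.exp (κ * s)) := by
              gcongr; exact hb s hs.1
          _ = c * (Real.exp (-s * μ.re) * Real.exp (κ * s)) := by ring
          _ = _ := by rw [← Real.exp_add]; ring_nf)
      (x := t) ⟨ht, le_rfl⟩
    rw [norm_smul, hn] at key
    have h1 : (1 : ℝ) ≤ Real.exp ((κ - μ.re) * t) := Real.one_le_exp (by positivity)
    calc ‖NormedSpace.exp (t • T) v‖
        = Real.exp (t * μ.re) * (Real.exp (-t * μ.re) * ‖NormedSpace.exp (t • T) v‖) := by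
          rw [← mul_assoc, ← Real.exp_add]; simp
      _ ≤ Real.exp (t * μ.re) *
          ((‖v‖ + c / (κ - μ.re)) * Real.exp ((κ - μ.re) * t)) := by
          refine mul_le_mul_of_nonneg_left (key.trans ?_) (Real.exp_pos _).le
          rw [add_mul]
          gcongr
          exact le_mul_of_one_le_right (norm_nonneg _) h1
      _ = (‖v‖ + c / (κ - μ.re)) * (Real.exp (t * μ.re) * Real.exp ((κ - μ.re) * t)) := by ring
      _ = _ := by rw [← Real.exp_add]; ring_nf

/-- The generalized eigenspace has dimension equal to the algebraic multiplicity, here one, so it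
coincides with the eigenspace. -/
theorem apply_eq_smul_of_mem_maxGenEigenspace_of_simple {V : Type*} [AddCommGroup V] [Module ℂ V]
    [FiniteDimensional ℂ V] (f : Module.End ℂ V) {μ : ℂ} (hμ : f.HasEigenvalue μ)
    (hs : f.charpoly.rootMultiplicity μ = 1) {v : V} (hv : v ∈ f.maxGenEigenspace μ) :
    f v = μ • v := by
  have hrank := LinearMap.finrank_maxGenEigenspace_eq f μ
  rw [hs] at hrank
  have hone : 1 ≤ Module.finrank ℂ (f.eigenspace μ) := Submodule.one_le_finrank_iff.2 hμ
  have heq := Submodule.eq_of_le_of_finrank_le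
    (Module.End.eigenspace_le_maxGenEigenspace (μ := μ) (f := f)) (hrank.trans_le hone)
  rw [← heq] at hv
  exact Module.End.mem_eigenspace_iff.1 hv

/-- The curve `e^{-sμ} e^{sT} v` has zero derivative, and its scalar factor has modulus one because
`Re μ = 0`. -/
theorem norm_exp_smul_apply_of_eigenvector
    (T : EuclideanSpace ℂ (Fin n) →L[ℂ] EuclideanSpace ℂ (Fin n))
    {μ : ℂ} (hμ : μ.re = 0) {v : EuclideanSpace ℂ (Fin n)} (hv : T v = μ • v) (t : ℝ) :
    ‖NormedSpace.exp (t • T) v‖ = ‖v‖ := by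
  have hd : ∀ s : ℝ, HasDerivAt
      (fun s : ℝ => Complex.exp (-(s : ℂ) * μ) • NormedSpace.exp (s • T) v) 0 s := by
    intro s
    have h1 : HasDerivAt (fun s : ℝ => NormedSpace.exp (s • T) v)
        (NormedSpace.exp (s • T) (T v)) s := by
      have := (hasDerivAt_exp_smul_const T s)
      exact ((ContinuousLinearMap.apply ℂ _ v).restrictScalars ℝ).hasFDerivAt.comp_hasDerivAt s this
    have h2 : HasDerivAt (fun s : ℝ => Complex.exp (-(s : ℂ) * μ))
        (Complex.exp (-(s : ℂ) * μ) * (-1 * μ)) s :=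
      ((Complex.ofRealCLM.hasDerivAt (x := s)).neg.mul_const μ).cexp
    convert! h2.smul h1 using 1
    rw [hv, map_smul, smul_smul, ← add_smul]
    simp
  have hc := is_const_of_deriv_eq_zero (fun s => (hd s).differentiableAt)
    (fun s => (hd s).deriv) t 0
  have hn := congrArg norm hc
  have hz : (0 : ℝ) • T = 0 := zero_smul ℝ T
  rw [norm_smul, Complex.norm_exp, hz] at hn
  simpa [hμ] using hn

/-- Over `ℂ` the generalized eigenspaces span, so a bound on each of them gives a bound on every
vector; applied to a basis, this controls the operator norm. -/
theorem exists_norm_exp_smul_le_of_forall_maxGenEigenspace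
    (T : EuclideanSpace ℂ (Fin n) →L[ℂ] EuclideanSpace ℂ (Fin n)) {g : ℝ → ℝ}
    (hg : ∀ t, 0 ≤ t → 0 ≤ g t)
    (h : ∀ μ : ℂ, ∀ v ∈ Module.End.maxGenEigenspace (T : Module.End ℂ (EuclideanSpace ℂ (Fin n))) μ,
      ∃ c : ℝ, 0 ≤ c ∧ ∀ t : ℝ, 0 ≤ t → ‖NormedSpace.exp (t • T) v‖ ≤ c * g t) :
    ∃ c : ℝ, 0 ≤ c ∧ ∀ t : ℝ, 0 ≤ t → ‖NormedSpace.exp (t • T)‖ ≤ c * g t := by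
  have hall : ∀ v, ∃ c : ℝ, 0 ≤ c ∧ ∀ t : ℝ, 0 ≤ t → ‖NormedSpace.exp (t • T) v‖ ≤ c * g t := by
    intro v
    have hv : v ∈ ⨆ μ, Module.End.maxGenEigenspace
        (T : Module.End ℂ (EuclideanSpace ℂ (Fin n))) μ := by
      rw [Module.End.iSup_maxGenEigenspace_eq_top]; trivial
    induction hv using Submodule.iSup_induction' with
    | mem μ v hv => exact h μ v hv
    | zero => exact ⟨0, le_rfl, fun t _ => by simp⟩
    | add v w _ _ hv hw =>
      obtain ⟨c, hc, hb⟩ := hv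
      obtain ⟨c', hc', hb'⟩ := hw
      refine ⟨c + c', by positivity, fun t ht => ?_⟩
      rw [map_add, add_mul]
      exact (norm_add_le _ _).trans (add_le_add (hb t ht) (hb' t ht))
  choose c hc hb using hall
  let b := Module.finBasis ℂ (EuclideanSpace ℂ (Fin n))
  obtain ⟨C, hC, hle⟩ := b.exists_opNorm_le (F := EuclideanSpace ℂ (Fin n))
  refine ⟨C * ∑ i, c (b i), mul_nonneg hC.le (Finset.sum_nonneg fun i _ => hc _), fun t ht => ?_⟩
  rw [mul_assoc]
  refine hle (mul_nonneg (Finset.sum_nonneg fun i _ => hc _) (hg t ht)) fun i => ?_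
  refine (hb (b i) t ht).trans ?_
  gcongr
  · exact hg t ht
  · exact Finset.single_le_sum (f := fun i => c (b i)) (fun i _ => hc _) (Finset.mem_univ i)

end ComplexGrowth

/-! ### Growth of real matrix exponentials, by complexification. -/

section RealExp

variable {n m : ℕ}

/-- The continuous linear map of a real matrix. -/
abbrev clm (A : Matrix (Fin m) (Fin n) ℝ) : E n →L[ℝ] E m :=
  LinearMap.toContinuousLinearMap A.toEuclideanLin

theorem clm_apply (A : Matrix (Fin m) (Fin n) ℝ) (v : E n) : clm A v = A.toEuclideanLin v := rfl

theorem toEuclideanLin_mul_apply {l : ℕ} (A : Matrix (Fin m) (Fin n) ℝ)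
    (B : Matrix (Fin n) (Fin l) ℝ) (v : E l) :
    (A * B).toEuclideanLin v = A.toEuclideanLin (B.toEuclideanLin v) := by
  ext i
  simp [Matrix.toLpLin_apply, Matrix.mulVec_mulVec]

/-- Passing from matrices to operators is a continuous algebra isomorphism, so it carries the
exponential series over term by term. -/
theorem toEuclideanLin_exp (A : Matrix (Fin n) (Fin n) ℝ) (v : E n) :
    (NormedSpace.exp A).toEuclideanLin v = NormedSpace.exp (clm A) v := by
  let e := (Matrix.toEuclideanCLM (n := Fin n) (𝕜 := ℝ)).toAlgEquiv
  have h : e (NormedSpace.exp A) = NormedSpace.exp (e A) := by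
    rw [NormedSpace.exp_eq_tsum ℝ, NormedSpace.exp_eq_tsum ℝ]
    refine (e.toLinearEquiv.toContinuousLinearEquiv.map_tsum).trans (tsum_congr fun k => ?_)
    change e _ = _
    rw [map_smul, map_pow]
  exact congrArg (fun T : E n →L[ℝ] E n => T v) h

/-- The complexification of a real vector. -/
def complexify (n : ℕ) : E n →L[ℝ] EuclideanSpace ℂ (Fin n) :=
  LinearMap.toContinuousLinearMap
    { toFun := fun v => WithLp.toLp 2 fun i => (v i : ℂ)
      map_add' := fun v w => by ext i; simp
      map_smul' := fun c v => by ext i; simp }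

theorem complexify_apply (v : E n) (i : Fin n) : complexify n v i = (v i : ℂ) := rfl

theorem norm_complexify (v : E n) : ‖complexify n v‖ = ‖v‖ := by
  simp [EuclideanSpace.norm_eq, complexify_apply]

theorem complexify_exp_apply {T : E n →L[ℝ] E n}
    {T' : EuclideanSpace ℂ (Fin n) →L[ℂ] EuclideanSpace ℂ (Fin n)}
    (h : ∀ v, complexify n (T v) = T' (complexify n v)) (v : E n) :
    complexify n (NormedSpace.exp T v) = NormedSpace.exp T' (complexify n v) := by
  have h1 := ((ContinuousLinearMap.apply ℝ _ v).hasSum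
    (NormedSpace.exp_series_hasSum_exp' (𝕂 := ℝ) T)).mapL (complexify n)
  have h2 := (ContinuousLinearMap.apply ℂ _ (complexify n v)).hasSum
    (NormedSpace.exp_series_hasSum_exp' (𝕂 := ℂ) T')
  refine h1.unique (h2.congr_fun fun k => ?_)
  have hk : ∀ k : ℕ, complexify n ((T ^ k) v) = (T' ^ k) (complexify n v) := by
    intro k
    induction k with
    | zero => simp
    | succ k ih =>
      rw [pow_succ', pow_succ', mul_apply_eq_comp, mul_apply_eq_comp, h, ih]
  simp only [ContinuousLinearMap.apply_apply, map_smul, hk]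
  rw [← Complex.coe_smul]
  simp

/-- Complexification of vectors is isometric and intertwines the two exponentials. -/
theorem norm_exp_clm_le (A : Matrix (Fin n) (Fin n) ℝ) (t : ℝ) :
    ‖NormedSpace.exp (t • clm A)‖ ≤
      ‖NormedSpace.exp (t • Matrix.toEuclideanCLM (n := Fin n) (𝕜 := ℂ)
        (A.map (algebraMap ℝ ℂ)))‖ := by
  refine ContinuousLinearMap.opNorm_le_bound _ (norm_nonneg _) fun v => ?_
  rw [← norm_complexify, ← norm_complexify v, complexify_exp_apply
    (T' := t • Matrix.toEuclideanCLM (n := Fin n) (𝕜 := ℂ) (A.map (algebraMap ℝ ℂ)))]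
  · exact ContinuousLinearMap.le_opNorm _ _
  · intro w
    ext i
    simp [complexify_apply, Matrix.toLpLin_apply, Matrix.mulVec, dotProduct]

theorem mem_spectrum_of_mem_maxGenEigenspace (A : Matrix (Fin n) (Fin n) ℂ) {μ : ℂ}
    {v : EuclideanSpace ℂ (Fin n)} (hv0 : v ≠ 0)
    (hv : v ∈ Module.End.maxGenEigenspace
      (A.toEuclideanLin : Module.End ℂ (EuclideanSpace ℂ (Fin n))) μ) :
    μ ∈ spectrum ℂ A ∧
      Module.End.HasEigenvalue (A.toEuclideanLin : Module.End ℂ (EuclideanSpace ℂ (Fin n))) μ := by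
  have h1 : Module.End.HasEigenvalue
      (A.toEuclideanLin : Module.End ℂ (EuclideanSpace ℂ (Fin n))) μ := by
    have : Module.End.HasUnifEigenvalue
        (A.toEuclideanLin : Module.End ℂ (EuclideanSpace ℂ (Fin n))) μ ⊤ := by
      intro h
      rw [Module.End.maxGenEigenspace, h] at hv
      exact hv0 (by simpa using hv)
    exact this.lt zero_lt_one
  refine ⟨?_, h1⟩
  have h2 := h1.mem_spectrum
  rwa [show (A.toEuclideanLin : Module.End ℂ (EuclideanSpace ℂ (Fin n)))
    = Matrix.toLpLinAlgEquiv 2 A from rfl, AlgEquiv.spectrum_eq] at h2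

theorem charpoly_toEuclideanLin (A : Matrix (Fin n) (Fin n) ℂ) :
    LinearMap.charpoly (A.toEuclideanLin : Module.End ℂ (EuclideanSpace ℂ (Fin n)))
      = A.charpoly := by
  rw [Matrix.toEuclideanLin_eq_toLin_orthonormal, Matrix.charpoly_toLin]

theorem NoUnstableEigenvalue.exists_norm_exp_le {A : Matrix (Fin n) (Fin n) ℝ}
    (hA : NoUnstableEigenvalue A) {κ : ℝ} (hκ : 0 < κ) :
    ∃ c : ℝ, 0 ≤ c ∧ ∀ t : ℝ, 0 ≤ t → ‖NormedSpace.exp (t • clm A)‖ ≤ c * Real.exp (κ * t) := by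
  obtain ⟨c, hc, hb⟩ := exists_norm_exp_smul_le_of_forall_maxGenEigenspace
    (Matrix.toEuclideanCLM (n := Fin n) (𝕜 := ℂ) (A.map (algebraMap ℝ ℂ)))
    (g := fun t => Real.exp (κ * t)) (fun t _ => by positivity) (by
      intro μ v hv
      by_cases hv0 : v = 0
      · exact ⟨0, le_rfl, fun t _ => by simp [hv0]⟩
      have hμ := hA μ (mem_spectrum_of_mem_maxGenEigenspace _ hv0 hv).1
      obtain ⟨k, hk⟩ := (Module.End.mem_maxGenEigenspace _ _ _).1 hv
      refine exists_norm_exp_smul_apply_le _ μ (by linarith) k v ?_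
      rw [← hk, ← ContinuousLinearMap.coe_coe, ContinuousLinearMap.toLinearMap_pow]
      rfl)
  exact ⟨c, hc, fun t ht => (norm_exp_clm_le A t).trans (hb t ht)⟩

theorem MarginallyStable.noUnstableEigenvalue {A : Matrix (Fin n) (Fin n) ℝ}
    (hA : MarginallyStable A) : NoUnstableEigenvalue A := fun μ hμ =>
  (hA μ hμ).elim le_of_lt fun h => h.1.le

theorem MarginallyStable.exists_norm_exp_le {A : Matrix (Fin n) (Fin n) ℝ}
    (hA : MarginallyStable A) :
    ∃ c : ℝ, 0 ≤ c ∧ ∀ t : ℝ, 0 ≤ t → ‖NormedSpace.exp (t • clm A)‖ ≤ c := by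
  obtain ⟨c, hc, hb⟩ := exists_norm_exp_smul_le_of_forall_maxGenEigenspace
    (Matrix.toEuclideanCLM (n := Fin n) (𝕜 := ℂ) (A.map (algebraMap ℝ ℂ)))
    (g := fun t => Real.exp (0 * t)) (fun t _ => by positivity) (by
      intro μ v hv
      by_cases hv0 : v = 0
      · exact ⟨0, le_rfl, fun t _ => by simp [hv0]⟩
      obtain ⟨hsp, hev⟩ := mem_spectrum_of_mem_maxGenEigenspace _ hv0 hv
      obtain hμ | ⟨hμ, hmult⟩ := hA μ hsp
      · obtain ⟨k, hk⟩ := (Module.End.mem_maxGenEigenspace _ _ _).1 hv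
        refine exists_norm_exp_smul_apply_le _ μ hμ k v ?_
        rw [← hk, ← ContinuousLinearMap.coe_coe, ContinuousLinearMap.toLinearMap_pow]
        rfl
      · have hv' := apply_eq_smul_of_mem_maxGenEigenspace_of_simple _ hev
          (by rw [charpoly_toEuclideanLin, hmult]) hv
        refine ⟨‖v‖, norm_nonneg _, fun t _ => ?_⟩
        rw [norm_exp_smul_apply_of_eigenvector _ hμ hv' t]
        simp)
  exact ⟨c, hc, fun t ht => (norm_exp_clm_le A t).trans (by simpa using hb t ht)⟩

end RealExp

/-! ### Removing the free motion `e^{tT}`. -/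

section ExpTransform

variable {n : ℕ}

theorem hasDerivAt_exp_neg_smul (T : E n →L[ℝ] E n) (t : ℝ) :
    HasDerivAt (fun t : ℝ => NormedSpace.exp ((-t) • T)) (-(NormedSpace.exp ((-t) • T) * T)) t := by
  have h := (hasDerivAt_exp_smul_const T (-t)).scomp t (hasDerivAt_neg t)
  rwa [neg_one_smul] at h

theorem continuous_exp_neg_smul (T : E n →L[ℝ] E n) :
    Continuous (fun t : ℝ => NormedSpace.exp ((-t) • T)) :=
  continuous_iff_continuousAt.2 fun t => (hasDerivAt_exp_neg_smul T t).continuousAt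

theorem exp_zero_smul_apply (T : E n →L[ℝ] E n) (v : E n) :
    NormedSpace.exp ((0 : ℝ) • T) v = v := by
  have hz : (0 : ℝ) • T = 0 := zero_smul ℝ T
  rw [hz, NormedSpace.exp_zero]
  rfl

theorem exp_smul_mul_exp_smul (T : E n →L[ℝ] E n) (s t : ℝ) :
    NormedSpace.exp (s • T) * NormedSpace.exp (t • T) = NormedSpace.exp ((s + t) • T) := by
  let _ : NormedAlgebra ℚ (E n →L[ℝ] E n) := NormedAlgebra.restrictScalars ℚ ℝ _
  have hadd : (s + t) • T = s • T + t • T := add_smul s t T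
  rw [hadd, NormedSpace.exp_add_of_commute]
  ext v
  simp [smul_comm s t]

theorem exp_smul_exp_smul_apply (T : E n →L[ℝ] E n) (s t : ℝ) (v : E n) :
    NormedSpace.exp (s • T) (NormedSpace.exp (t • T) v) = NormedSpace.exp ((s + t) • T) v := by
  rw [← exp_smul_mul_exp_smul]
  rfl

theorem IsPrimitive.exp_neg_smul (T : E n →L[ℝ] E n) {x f : ℝ → E n} (h : IsPrimitive x f) :
    IsPrimitive (fun t => NormedSpace.exp ((-t) • T) (x t))
      (fun t => NormedSpace.exp ((-t) • T) (f t - T (x t))) := by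
  have h1 : IsPrimitive (fun t : ℝ => NormedSpace.exp ((-t) • T))
      (fun t => -(NormedSpace.exp ((-t) • T) * T)) :=
    IsPrimitive.of_hasDerivAt (hasDerivAt_exp_neg_smul T)
      ((continuous_exp_neg_smul T).mul continuous_const).neg
  have h2 := h1.bilin (ContinuousLinearMap.id ℝ (E n →L[ℝ] E n)) h
  refine h2.congr_right fun t _ => ?_
  simp only [ContinuousLinearMap.id_apply, map_sub]
  rw [sub_eq_add_neg, add_comm]
  rfl

/-- The solution of an autonomous linear equation. -/
theorem IsPrimitive.eq_exp_smul (T : E n →L[ℝ] E n) {x : ℝ → E n}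
    (h : IsPrimitive x fun t => T (x t)) {t : ℝ} (ht : 0 ≤ t) :
    x t = NormedSpace.exp (t • T) (x 0) := by
  have h1 := ((h.exp_neg_smul T) t ht).2
  simp only [sub_self, map_zero, intervalIntegral.integral_zero, add_zero, neg_zero,
    exp_zero_smul_apply] at h1
  rw [← h1, exp_smul_exp_smul_apply, add_neg_cancel, exp_zero_smul_apply]

end ExpTransform

/-! ### Comparison principle for the delayed consensus equation. -/

section Consensus

variable {N n : ℕ}

/-- Comparison principle for delayed consensus dynamics: `m_j e^{-κ t}` is a supersolution. -/
theorem norm_le_of_supersolution {a : Fin N → Fin (N + 1) → ℝ} (ha : ∀ i j, 0 ≤ a i j)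
    {ϵ κ τcbar C : ℝ} (hϵ : 0 < ϵ) (hκ : 0 < κ) (hτ0 : 0 ≤ τcbar) (hC : 0 ≤ C)
    {τ : Fin N → Fin (N + 1) → ℝ → ℝ}
    (hτ : ∀ i j t, a i j ≠ 0 → 0 ≤ t → 0 ≤ τ i j t ∧ τ i j t ≤ τcbar)
    {m : Fin (N + 1) → ℝ} (hm : ∀ j, 0 < m j)
    (hsuper : ∀ i, ϵ * ∑ j, a i j * (m j * Real.exp (κ * τcbar))
      ≤ (ϵ * ∑ j, a i j - κ) * m i.succ)
    {d : Fin (N + 1) → ℝ → E n}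
    (hd : ∀ i : Fin N, IsPrimitive (d i.succ)
      fun t => ϵ • ∑ j, a i j • (d j (t - τ i j t) - d i.succ t))
    (hinit : ∀ j t, -τcbar ≤ t → t ≤ 0 → ‖d j t‖ ≤ C * m j * Real.exp (-κ * t))
    (hlead : ∀ t, 0 ≤ t → d 0 t = 0) (i : Fin N) (t : ℝ) (ht : 0 ≤ t) :
    ‖d i.succ t‖ ≤ C * m i.succ * Real.exp (-κ * t) := by
  -- Feeding a bound with constant `K` on `[0, T]` back into the equation: with the integrating
  -- factor `e^{l t}`, where `l` is the total incoming gain, the supersolution inequality bounds the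
  -- integrand by the derivative of `K m_i e^{(l - κ) t}`. Only the initial value contributes `C`
  -- instead of `K`.
  have step : ∀ T K : ℝ, 0 ≤ T → C ≤ K →
      (∀ (i : Fin N) (t : ℝ), 0 ≤ t → t ≤ T →
        ‖d i.succ t‖ ≤ K * m i.succ * Real.exp (-κ * t)) →
      ∀ i : Fin N, Real.exp ((ϵ * ∑ j, a i j) * T) * ‖d i.succ T‖ ≤ C * m i.succ +
        K * m i.succ * (Real.exp ((ϵ * ∑ j, a i j - κ) * T) - 1) := by
    intro T K hT hCK hK i
    have hK0 : 0 ≤ K := hC.trans hCK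
    have hall : ∀ j t, -τcbar ≤ t → t ≤ T → ‖d j t‖ ≤ K * m j * Real.exp (-κ * t) := by
      intro j t h1 h2
      rcases le_total t 0 with h0 | h0
      · refine (hinit j t h1 h0).trans ?_
        have := (hm j).le
        gcongr
      · induction j using Fin.cases with
        | zero =>
          rw [hlead t h0, norm_zero]
          have := (hm 0).le
          positivity
        | succ j => exact hK j t h0 h2
    set l := ϵ * ∑ j, a i j with hl
    have hexp : IsPrimitive (fun t : ℝ => Real.exp (l * t)) (fun t => Real.exp (l * t) * l) := by
      refine IsPrimitive.of_hasDerivAt (fun t => ?_) (by fun_prop)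
      simpa using ((hasDerivAt_id t).const_mul l).exp
    have hprim := hexp.bilin (ContinuousLinearMap.lsmul ℝ ℝ) (hd i)
    have hprim' : IsPrimitive (fun t => Real.exp (l * t) • d i.succ t)
        (fun t => (Real.exp (l * t) * ϵ) • ∑ j, a i j • d j (t - τ i j t)) := by
      refine hprim.congr_right fun t _ => ?_
      simp only [ContinuousLinearMap.lsmul_apply, smul_sub, Finset.sum_sub_distrib, smul_smul,
        ← Finset.sum_smul, hl]
      rw [mul_comm ϵ, mul_assoc]
      abel
    have h1 := (hprim' T hT).2
    simp only [mul_zero, Real.exp_zero, one_smul] at h1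
    have hI : ∫ s in (0 : ℝ)..T, K * m i.succ * ((l - κ) * Real.exp ((l - κ) * s))
        = K * m i.succ * (Real.exp ((l - κ) * T) - 1) := by
      rw [intervalIntegral.integral_const_mul]
      congr 1
      simp
    have h2 : ‖∫ s in (0 : ℝ)..T, (Real.exp (l * s) * ϵ) • ∑ j, a i j • d j (s - τ i j s)‖
        ≤ ∫ s in (0 : ℝ)..T, K * m i.succ * ((l - κ) * Real.exp ((l - κ) * s)) := by
      refine intervalIntegral.norm_integral_le_of_norm_le hT (Eventually.of_forall fun s hs => ?_)
        (Continuous.intervalIntegrable (by fun_prop) _ _)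
      rw [norm_smul, Real.norm_of_nonneg (by positivity)]
      have h3 : ‖∑ j, a i j • d j (s - τ i j s)‖
          ≤ K * Real.exp (-κ * s) * ∑ j, a i j * (m j * Real.exp (κ * τcbar)) := by
        refine (norm_sum_le _ _).trans ?_
        rw [Finset.mul_sum]
        refine Finset.sum_le_sum fun j _ => ?_
        rw [norm_smul, Real.norm_of_nonneg (ha i j)]
        by_cases hij : a i j = 0
        · simp [hij]
        obtain ⟨h4, h5⟩ := hτ i j s hij hs.1.le
        have h6 := hall j (s - τ i j s) (by linarith [hs.1]) (by linarith [hs.2])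
        have h7 : Real.exp (-κ * (s - τ i j s)) ≤ Real.exp (-κ * s) * Real.exp (κ * τcbar) := by
          rw [← Real.exp_add, Real.exp_le_exp]
          nlinarith
        have := (hm j).le
        calc a i j * ‖d j (s - τ i j s)‖
            ≤ a i j * (K * m j * (Real.exp (-κ * s) * Real.exp (κ * τcbar))) := by
              refine mul_le_mul_of_nonneg_left (h6.trans ?_) (ha i j)
              gcongr
          _ = _ := by ring
      calc Real.exp (l * s) * ϵ * ‖∑ j, a i j • d j (s - τ i j s)‖
          ≤ Real.exp (l * s) * ϵ *
            (K * Real.exp (-κ * s) * ∑ j, a i j * (m j * Real.exp (κ * τcbar))) := by gcongr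
        _ = K * (Real.exp (l * s) * Real.exp (-κ * s)) *
            (ϵ * ∑ j, a i j * (m j * Real.exp (κ * τcbar))) := by ring
        _ ≤ K * (Real.exp (l * s) * Real.exp (-κ * s)) * ((l - κ) * m i.succ) := by
            exact mul_le_mul_of_nonneg_left (hsuper i) (by positivity)
        _ = K * m i.succ * ((l - κ) * (Real.exp (l * s) * Real.exp (-κ * s))) := by ring
        _ = _ := by rw [← Real.exp_add]; ring_nf
    rw [hI] at h2
    have h3 := hinit i.succ 0 (by linarith) le_rfl
    simp only [mul_zero, Real.exp_zero, mul_one] at h3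
    calc Real.exp (l * T) * ‖d i.succ T‖ = ‖Real.exp (l * T) • d i.succ T‖ := by
          rw [norm_smul, Real.norm_of_nonneg (Real.exp_pos _).le]
      _ ≤ _ := by
          rw [h1]
          exact (norm_add_le _ _).trans (add_le_add h3 h2)
  -- The ratio of `‖d_i‖` to the supersolution; its maximum over agents and over `[0, t]` is the
  -- best constant `K`.
  let φ : Fin N → ℝ → ℝ := fun i s => ‖d i.succ s‖ * Real.exp (κ * s) / m i.succ
  have hφ : ∀ i, ContinuousOn (φ i) (Set.Icc 0 t) := by
    intro i
    have := (hd i).continuousOn.mono (s := Set.Ici (0 : ℝ)) (t := Set.Icc 0 t) fun s hs => hs.1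
    fun_prop
  have hmax : ∀ i, ∃ s ∈ Set.Icc 0 t, ∀ r ∈ Set.Icc 0 t, φ i r ≤ φ i s := fun i =>
    isCompact_Icc.exists_isMaxOn ⟨0, le_rfl, ht⟩ (hφ i)
  choose σ hσ hσmax using hmax
  have : Nonempty (Fin N) := ⟨i⟩
  obtain ⟨k, hk⟩ := Finite.exists_max fun i => φ i (σ i)
  have hbound : ∀ (i : Fin N) (s : ℝ), 0 ≤ s → s ≤ t →
      ‖d i.succ s‖ ≤ φ k (σ k) * m i.succ * Real.exp (-κ * s) := by
    intro i s h0 h1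
    have h2 := (hσmax i s ⟨h0, h1⟩).trans (hk i)
    have h3 := (div_le_iff₀ (hm i.succ)).1 h2
    calc ‖d i.succ s‖ = ‖d i.succ s‖ * Real.exp (κ * s) * Real.exp (-κ * s) := by
          rw [mul_assoc, ← Real.exp_add]; simp
      _ ≤ _ := by gcongr
  have hle : φ k (σ k) ≤ C := by
    -- At the point where the maximum `K` is attained, `step` reads `K m e ≤ C m + K m (e - 1)` with
    -- `e = e^{(l - κ) σ}`, that is, `K ≤ C`.
    by_contra! hlt
    have h1 := step (σ k) (φ k (σ k)) (hσ k).1 hlt.le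
      (fun i s h0 h1 => hbound i s h0 (h1.trans (hσ k).2)) k
    have h2 : ‖d k.succ (σ k)‖ = φ k (σ k) * m k.succ * Real.exp (-κ * σ k) := by
      have : φ k (σ k) * m k.succ = ‖d k.succ (σ k)‖ * Real.exp (κ * σ k) :=
        div_mul_cancel₀ _ (hm k.succ).ne'
      rw [this, mul_assoc, ← Real.exp_add]
      simp
    rw [h2, show ∀ x y z : ℝ, x * (y * z) = y * (x * z) from fun x y z => by ring,
      ← Real.exp_add] at h1
    have h3 : (ϵ * ∑ j, a k j) * σ k + -κ * σ k = (ϵ * ∑ j, a k j - κ) * σ k := by ring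
    rw [h3] at h1
    have := hm k.succ
    nlinarith
  refine (hbound i t ht le_rfl).trans ?_
  have := (hm i.succ).le
  gcongr

end Consensus

/-! ### Weights on the graph that make the consensus dynamics contract. -/

section Weights

variable {N : ℕ}

/-- The weights with self-loops removed. -/
def coupling (G : Digraph (Fin (N + 1))) (i : Fin N) (j : Fin (N + 1)) : ℝ :=
  if j = i.succ then 0 else weight G i.succ j

theorem weight_nonneg (G : Digraph (Fin (N + 1))) (i j : Fin (N + 1)) : 0 ≤ weight G i j := by
  unfold weight
  split_ifs <;> norm_num

theorem weight_le_one (G : Digraph (Fin (N + 1))) (i j : Fin (N + 1)) : weight G i j ≤ 1 := by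
  unfold weight
  split_ifs <;> norm_num

theorem coupling_nonneg (G : Digraph (Fin (N + 1))) (i : Fin N) (j : Fin (N + 1)) :
    0 ≤ coupling G i j := by
  unfold coupling
  split_ifs
  · exact le_rfl
  · exact weight_nonneg _ _ _

theorem coupling_le_one (G : Digraph (Fin (N + 1))) (i : Fin N) (j : Fin (N + 1)) :
    coupling G i j ≤ 1 := by
  unfold coupling
  split_ifs
  · exact zero_le_one
  · exact weight_le_one _ _ _

theorem adj_of_coupling_ne_zero {G : Digraph (Fin (N + 1))} {i : Fin N} {j : Fin (N + 1)}
    (h : coupling G i j ≠ 0) : G.Adj j i.succ := by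
  by_contra hn
  exact h (by simp [coupling, weight, hn])

/-- The vertex `i` is reached from the leader by a walk of length `k`. -/
def ReachableIn (G : Digraph (Fin (N + 1))) : ℕ → Fin (N + 1) → Prop
  | 0, i => i = 0
  | k + 1, i => ∃ j, ReachableIn G k j ∧ G.Adj j i

/-- A rank function that decreases along some incoming edge of each follower. -/
theorem LeaderRooted.exists_rank {G : Digraph (Fin (N + 1))} (hG : LeaderRooted G) :
    ∃ r : Fin (N + 1) → ℕ, ∀ i : Fin N, ∃ j, G.Adj j i.succ ∧ r j < r i.succ := by
  have hex : ∀ i, ∃ k, ReachableIn G k i := by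
    intro i
    induction hG i with
    | refl => exact ⟨0, rfl⟩
    | tail _ hadj ih =>
      obtain ⟨k, hk⟩ := ih
      exact ⟨k + 1, _, hk, hadj⟩
  classical
  let r : Fin (N + 1) → ℕ := fun i => Nat.find (hex i)
  refine ⟨r, fun i => ?_⟩
  have hspec : ReachableIn G (r i.succ) i.succ := Nat.find_spec (hex i.succ)
  rcases hk : r i.succ with _ | k
  · rw [hk] at hspec
    exact absurd hspec (Fin.succ_ne_zero i)
  · rw [hk] at hspec
    obtain ⟨j, hj, hadj⟩ := hspec
    exact ⟨j, hadj, Nat.lt_succ_of_le (Nat.find_min' (hex j) hj)⟩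

/-- This is the supersolution condition at `κ = 0`, in strict form. The potential increases with the
distance from the leader, but with geometrically decreasing increments, so one edge from a vertex of
lower rank outweighs all other incoming edges. -/
theorem LeaderRooted.exists_potential {G : Digraph (Fin (N + 1))} (hG : LeaderRooted G) :
    ∃ m : Fin (N + 1) → ℝ, (∀ j, 1 / 2 ≤ m j) ∧ (∀ j, m j ≤ 1) ∧
      ∀ i : Fin N, ∑ j, coupling G i j * m j < (∑ j, coupling G i j) * m i.succ := by
  obtain ⟨r, hr⟩ := hG.exists_rank
  have hN : (0 : ℝ) < N + 2 := by positivity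
  -- In row `i` the edge from a lower rank contributes at least `ρ^r (1 - ρ)`, with `r` the rank of
  -- `i`, and each of the other `N` terms at least `-ρ^{r+1}`; the total is positive because `(N +
  -- 1) ρ < 1`.
  set ρ : ℝ := 1 / (N + 2) with hρ
  have hρ0 : 0 < ρ := by positivity
  have hρ1 : ρ ≤ 1 / 2 := by
    rw [hρ]
    exact one_div_le_one_div_of_le (by norm_num) (by linarith [(Nat.cast_nonneg N : (0 : ℝ) ≤ N)])
  have hρ1' : ρ ≤ 1 := by linarith
  refine ⟨fun j => 1 - ρ ^ (r j + 1), fun j => ?_, fun j => ?_, fun i => ?_⟩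
  · have : ρ ^ (r j + 1) ≤ ρ ^ 1 := pow_le_pow_of_le_one hρ0.le hρ1' (by omega)
    simp only [pow_one] at this
    linarith
  · have : 0 < ρ ^ (r j + 1) := by positivity
    linarith
  · obtain ⟨j₀, hadj, hlt⟩ := hr i
    have hne : j₀ ≠ i.succ := fun h => by simp [h] at hlt
    have hone : coupling G i j₀ = 1 := by simp [coupling, hne, weight, hadj]
    have hpow : ρ ^ (r i.succ) ≤ ρ ^ (r j₀ + 1) :=
      pow_le_pow_of_le_one hρ0.le hρ1' (by omega)
    have hp : 0 < ρ ^ (r i.succ) := by positivity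
    rw [Finset.sum_mul, ← sub_pos, ← Finset.sum_sub_distrib,
      ← Finset.add_sum_erase _ _ (Finset.mem_univ j₀), hone]
    have hsum : -(N * (ρ ^ (r i.succ) * ρ)) ≤ ∑ j ∈ Finset.univ.erase j₀,
        (coupling G i j * (1 - ρ ^ (r i.succ + 1)) - coupling G i j * (1 - ρ ^ (r j + 1))) := by
      have hcard : ((Finset.univ.erase j₀).card : ℝ) = N := by
        simp [Finset.card_erase_of_mem]
      rw [← hcard, ← mul_neg, ← nsmul_eq_mul]
      refine Finset.card_nsmul_le_sum _ _ _ fun j _ => ?_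
      have h0 := coupling_nonneg G i j
      have h1 := coupling_le_one G i j
      have h2 : 0 < ρ ^ (r j + 1) := by positivity
      rw [pow_succ ρ (r i.succ)]
      have h3 : 0 < ρ ^ (r i.succ) * ρ := by positivity
      nlinarith
    have hid : ρ * (N + 2) = 1 := by rw [hρ]; field_simp
    simp only [pow_succ ρ (r i.succ)] at hsum ⊢
    nlinarith

/-- The strict inequalities at `κ = 0` are finitely many and continuous in `κ`, so they persist for
small positive `κ`, whatever the delay bound. -/
theorem LeaderRooted.exists_supersolution {G : Digraph (Fin (N + 1))} (hG : LeaderRooted G)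
    {ϵ : ℝ} (hϵ : 0 < ϵ) (τcbar : ℝ) :
    ∃ (m : Fin (N + 1) → ℝ) (κ : ℝ), 0 < κ ∧ (∀ j, 1 / 2 ≤ m j) ∧ (∀ j, m j ≤ 1) ∧
      ∀ i : Fin N, ϵ * ∑ j, coupling G i j * (m j * Real.exp (κ * τcbar))
        ≤ (ϵ * ∑ j, coupling G i j - κ) * m i.succ := by
  obtain ⟨m, hm1, hm2, hm3⟩ := hG.exists_potential
  have hev : ∀ᶠ κ in 𝓝[>] (0 : ℝ), ∀ i : Fin N,
      ϵ * ∑ j, coupling G i j * (m j * Real.exp (κ * τcbar))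
        ≤ (ϵ * ∑ j, coupling G i j - κ) * m i.succ := by
    rw [eventually_all]
    intro i
    have h0 : ∀ᶠ κ in 𝓝 (0 : ℝ), ϵ * ∑ j, coupling G i j * (m j * Real.exp (κ * τcbar))
        < (ϵ * ∑ j, coupling G i j - κ) * m i.succ := by
      have hl : Continuous fun κ : ℝ =>
        ϵ * ∑ j, coupling G i j * (m j * Real.exp (κ * τcbar)) := by fun_prop
      have hr : Continuous fun κ : ℝ => (ϵ * ∑ j, coupling G i j - κ) * m i.succ := by fun_prop
      refine (hl.tendsto 0).eventually_lt (hr.tendsto 0) ?_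
      simp only [zero_mul, Real.exp_zero, mul_one, sub_zero, mul_assoc]
      exact mul_lt_mul_of_pos_left (hm3 i) hϵ
    exact (h0.filter_mono nhdsWithin_le_nhds).mono fun κ h => h.le
  obtain ⟨κ, h1, h2⟩ := (hev.and self_mem_nhdsWithin).exists
  exact ⟨m, κ, h2, hm1, hm2, h1⟩

end Weights

/-! ### Exponential convergence of the observers. -/

section Observer

variable {N n : ℕ}

/-- Treats the leader as agent `0` of a single network, as the comparison principle requires; the
missing self-term is absorbed by the zero diagonal of `coupling`. -/
theorem observerRHS_eq (G : Digraph (Fin (N + 1))) (ϵ : ℝ)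
    (τc : Fin N → Fin (N + 1) → ℝ → ℝ) (A : Matrix (Fin n) (Fin n) ℝ)
    (x₀ : ℝ → E n) (ξ : Fin N → ℝ → E n) (i : Fin N) (t : ℝ) :
    observerRHS G ϵ τc A x₀ ξ i t = clm A (ξ i t) + ϵ • ∑ j, coupling G i j •
      (NormedSpace.exp (τc i j t • clm A) ((Fin.cons x₀ ξ : Fin (N + 1) → ℝ → E n) j
        (t - τc i j t)) - ξ i t) := by
  have hclm : ∀ (s : ℝ) (v : E n), (NormedSpace.exp (s • A)).toEuclideanLin v
      = NormedSpace.exp (s • clm A) v := by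
    intro s v
    rw [toEuclideanLin_exp]
    simp [clm]
  rw [observerRHS, Fin.sum_univ_succ, ← Finset.add_sum_erase _ _ (Finset.mem_univ i)]
  simp only [Fin.cons_zero, Fin.cons_succ, hclm, clm_apply]
  have h0 : coupling G i 0 = weight G i.succ 0 := by
    simp [coupling, (Fin.succ_ne_zero i).symm]
  have hi : coupling G i i.succ = 0 := by simp [coupling]
  have hj : ∀ j ∈ Finset.univ.erase i, coupling G i j.succ = weight G i.succ j.succ := by
    intro j hj
    simp [coupling, Finset.ne_of_mem_erase hj]
  have hsum := Finset.sum_congr (rfl : Finset.univ.erase i = Finset.univ.erase i) fun j hj' =>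
    congrArg (· • (NormedSpace.exp (τc i j.succ t • clm A) (ξ j (t - τc i j.succ t)) - ξ i t))
      (hj j hj')
  rw [h0, hi, zero_smul, zero_add, hsum, smul_add, smul_smul]
  abel

theorem CommDelays.bar_nonneg {G : Digraph (Fin (N + 1))} {τcbar : ℝ}
    {τc : Fin N → Fin (N + 1) → ℝ → ℝ} (hτc : CommDelays G τcbar τc) (hG : LeaderRooted G)
    (i : Fin N) : 0 ≤ τcbar := by
  obtain ⟨r, hr⟩ := hG.exists_rank
  obtain ⟨j, hadj, _⟩ := hr i
  exact (hτc.nonneg i j 0 hadj le_rfl).trans (hτc.le_bar i j 0 hadj le_rfl)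

/-- The observers converge exponentially to the state of the leader. -/
theorem exists_observer_error_bound {G : Digraph (Fin (N + 1))} (hG : LeaderRooted G)
    {ϵ : ℝ} (hϵ : 0 < ϵ) {τcbar : ℝ} {τc : Fin N → Fin (N + 1) → ℝ → ℝ}
    (hτc : CommDelays G τcbar τc) {A : Matrix (Fin n) (Fin n) ℝ} (hA : NoUnstableEigenvalue A) :
    ∃ c κ : ℝ, 0 ≤ c ∧ 0 < κ ∧ ∀ (x₀ : ℝ → E n) (ξ : Fin N → ℝ → E n) (D : ℝ),
      IsSolution x₀ (fun t => A.toEuclideanLin (x₀ t)) → (∀ i t, t ≤ 0 → ξ i t = 0) →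
      (∀ i, IsSolution (ξ i) (observerRHS G ϵ τc A x₀ ξ i)) →
      (∀ s ∈ Set.Icc (-τcbar) 0, ‖x₀ s‖ ≤ D) → 0 ≤ D →
      ∀ i t, 0 ≤ t → ‖ξ i t - x₀ t‖ ≤ c * D * Real.exp (-κ * t) := by
  obtain ⟨m, κ, hκ, hm1, hm2, hm3⟩ := hG.exists_supersolution hϵ τcbar
  -- Half of the decay rate is spent on the possible growth of `e^{tA}`, which is subexponential but
  -- need not be bounded.
  obtain ⟨c, hc, hgrow⟩ := hA.exists_norm_exp_le (half_pos hκ)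
  obtain ⟨K, hK⟩ := (isCompact_Icc (a := -τcbar) (b := 0)).exists_bound_of_continuousOn
    (continuous_exp_neg_smul (clm A)).continuousOn
  -- On the initial interval `‖d_j‖ ≤ (K + 1) D`; the factor `2` compensates `m_j ≥ 1/2`. The
  -- maximum with `0` is needed because `K` may be negative when the interval is empty.
  refine ⟨c * (2 * (max K 0 + 1)), κ / 2, by positivity, by positivity, ?_⟩
  intro x₀ ξ D hx₀ hξ0 hξ hD hD0 i t ht
  have hτ0 : 0 ≤ τcbar := hτc.bar_nonneg hG i
  have hx00 : ‖x₀ 0‖ ≤ D := hD 0 ⟨by linarith, le_rfl⟩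
  have hlead : ∀ t, 0 ≤ t → x₀ t = NormedSpace.exp (t • clm A) (x₀ 0) := fun t ht =>
    IsPrimitive.eq_exp_smul (clm A) hx₀ ht
  let X : Fin (N + 1) → ℝ → E n := Fin.cons x₀ ξ
  -- Since `e^{-tA} e^{τA} = e^{-(t - τ)A}`, the delay compensation in the observer turns into a
  -- plain evaluation of `d_j` at `t - τ`.
  let d : Fin (N + 1) → ℝ → E n := fun j t => NormedSpace.exp ((-t) • clm A) (X j t) - x₀ 0
  have hd : ∀ i : Fin N, IsPrimitive (d i.succ)
      fun t => ϵ • ∑ j, coupling G i j • (d j (t - τc i j t) - d i.succ t) := by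
    intro i
    have h := ((hξ i).isPrimitive.exp_neg_smul (clm A)).sub (IsPrimitive.const (x₀ 0))
    refine h.congr_right fun t _ => ?_
    simp only [observerRHS_eq, add_sub_cancel_left, map_smul, map_sum, map_sub, sub_zero]
    congr 1
    refine Finset.sum_congr rfl fun j _ => ?_
    rw [exp_smul_exp_smul_apply, sub_sub_sub_cancel_right,
      show -t + τc i j t = -(t - τc i j t) by ring]
    rfl
  have hinit : ∀ j t, -τcbar ≤ t → t ≤ 0 →
      ‖d j t‖ ≤ (2 * (max K 0 + 1) * D) * m j * Real.exp (-κ * t) := by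
    intro j t h1 h2
    have hX : ‖X j t‖ ≤ D := by
      induction j using Fin.cases with
      | zero => exact hD t ⟨h1, h2⟩
      | succ j =>
        have : X j.succ t = 0 := hξ0 j t h2
        rw [this, norm_zero]
        exact hD0
    have h3 : ‖d j t‖ ≤ (max K 0 + 1) * D := by
      refine (norm_sub_le _ _).trans ?_
      rw [add_mul, one_mul]
      refine add_le_add ((ContinuousLinearMap.le_opNorm _ _).trans ?_) hx00
      have := (hK t ⟨h1, h2⟩).trans (le_max_left K 0)
      gcongr
    have h4 : (1 : ℝ) ≤ Real.exp (-κ * t) := Real.one_le_exp (by nlinarith)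
    have h5 : (1 : ℝ) ≤ 2 * m j * Real.exp (-κ * t) := by nlinarith [hm1 j]
    calc ‖d j t‖ ≤ (max K 0 + 1) * D := h3
      _ ≤ (max K 0 + 1) * D * (2 * m j * Real.exp (-κ * t)) :=
          le_mul_of_one_le_right (by positivity) h5
      _ = _ := by ring
  have hmain := norm_le_of_supersolution (coupling_nonneg G) hϵ hκ hτ0
    (C := 2 * (max K 0 + 1) * D) (by positivity)
    (fun i j t hij ht => ⟨hτc.nonneg i j t (adj_of_coupling_ne_zero hij) ht,
      hτc.le_bar i j t (adj_of_coupling_ne_zero hij) ht⟩)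
    (fun j => by linarith [hm1 j]) hm3 hd hinit
    (fun t ht => by
      change NormedSpace.exp ((-t) • clm A) (x₀ t) - x₀ 0 = 0
      rw [hlead t ht, exp_smul_exp_smul_apply, neg_add_cancel, exp_zero_smul_apply, sub_self]) i t ht
  have herr : ξ i t - x₀ t = NormedSpace.exp (t • clm A) (d i.succ t) := by
    change _ = NormedSpace.exp (t • clm A) (NormedSpace.exp ((-t) • clm A) (ξ i t) - x₀ 0)
    rw [map_sub, exp_smul_exp_smul_apply, ← hlead t ht, add_neg_cancel, exp_zero_smul_apply]
  rw [herr]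
  calc ‖NormedSpace.exp (t • clm A) (d i.succ t)‖
      ≤ (c * Real.exp (κ / 2 * t)) * (2 * (max K 0 + 1) * D * 1 * Real.exp (-κ * t)) := by
        refine (ContinuousLinearMap.le_opNorm _ _).trans ?_
        refine mul_le_mul (hgrow t ht) (hmain.trans ?_) (norm_nonneg _) (by positivity)
        gcongr
        exact hm2 _
    _ = c * (2 * (max K 0 + 1)) * D * (Real.exp (κ / 2 * t) * Real.exp (-κ * t)) := by ring
    _ = _ := by rw [← Real.exp_add]; ring_nf

end Observer

/-! ### Bilinear forms of matrices. -/

section Form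

variable {n m l : ℕ}

/-- The bilinear form `(a, b) ↦ aᵀ R b` of a matrix. -/
def form (R : Matrix (Fin m) (Fin n) ℝ) : E m →L[ℝ] E n →L[ℝ] ℝ :=
  (innerSL ℝ).bilinearComp (ContinuousLinearMap.id ℝ (E m)) (clm R)

theorem form_apply (R : Matrix (Fin m) (Fin n) ℝ) (a : E m) (b : E n) :
    form R a b = inner ℝ a (clm R b) := rfl

theorem form_eq_dotProduct (R : Matrix (Fin m) (Fin n) ℝ) (a : E m) (b : E n) :
    form R a b = a.ofLp ⬝ᵥ R.mulVec b.ofLp := by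
  rw [form_apply, EuclideanSpace.inner_eq_star_dotProduct, dotProduct_comm]
  rfl

theorem form_add (R S : Matrix (Fin m) (Fin n) ℝ) (a : E m) (b : E n) :
    form (R + S) a b = form R a b + form S a b := by
  simp [form_eq_dotProduct, Matrix.add_mulVec]

theorem form_sub (R S : Matrix (Fin m) (Fin n) ℝ) (a : E m) (b : E n) :
    form (R - S) a b = form R a b - form S a b := by
  simp [form_eq_dotProduct, Matrix.sub_mulVec]

theorem form_neg (R : Matrix (Fin m) (Fin n) ℝ) (a : E m) (b : E n) :
    form (-R) a b = -form R a b := by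
  simp [form_eq_dotProduct, Matrix.neg_mulVec]

theorem form_smul (c : ℝ) (R : Matrix (Fin m) (Fin n) ℝ) (a : E m) (b : E n) :
    form (c • R) a b = c * form R a b := by
  simp [form_eq_dotProduct, Matrix.smul_mulVec]

theorem form_zero (a : E m) (b : E n) : form (0 : Matrix (Fin m) (Fin n) ℝ) a b = 0 := by
  simp [form_eq_dotProduct]

theorem form_one (a b : E n) : form (1 : Matrix (Fin n) (Fin n) ℝ) a b = inner ℝ a b := by
  rw [form_eq_dotProduct, EuclideanSpace.inner_eq_star_dotProduct, dotProduct_comm]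
  simp

theorem form_transpose (R : Matrix (Fin m) (Fin n) ℝ) (a : E n) (b : E m) :
    form R.transpose a b = form R b a := by
  rw [form_eq_dotProduct, form_eq_dotProduct, Matrix.mulVec_transpose, dotProduct_comm,
    Matrix.dotProduct_mulVec]

theorem form_mul_right (R : Matrix (Fin m) (Fin n) ℝ) (T : Matrix (Fin n) (Fin l) ℝ) (a : E m)
    (b : E l) : form (R * T) a b = form R a (clm T b) := by
  simp only [form_apply, clm_apply, toEuclideanLin_mul_apply]

theorem form_comm {R : Matrix (Fin n) (Fin n) ℝ} (hR : R.IsHermitian) (a b : E n) :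
    form R a b = form R b a := by
  rw [← form_transpose, ← Matrix.conjTranspose_eq_transpose_of_trivial, hR.eq]

theorem form_self_nonneg {R : Matrix (Fin n) (Fin n) ℝ} (hR : R.PosSemidef) (a : E n) :
    0 ≤ form R a a := by
  rw [form_eq_dotProduct]
  simpa using hR.dotProduct_mulVec_nonneg a.ofLp

theorem form_unbar (P M : Matrix (Fin n) (Fin n) ℝ) (a : E n) :
    form (unbar P M) a a = form P (clm M⁻¹ a) (clm M⁻¹ a) := by
  rw [unbar, form_mul_right, ← form_transpose, Matrix.transpose_mul, form_mul_right,
    Matrix.transpose_transpose, form_transpose]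

/-- Expanding `z` in an orthonormal eigenbasis makes the form a sum of eigenvalues times squared
coordinates. -/
theorem lambdaMin_mul_norm_sq_le {P : Matrix (Fin n) (Fin n) ℝ} (hP : P.IsHermitian) (z : E n) :
    lambdaMin P * ‖z‖ ^ 2 ≤ form P z z := by
  have h1 : form P z z = ∑ i, hP.eigenvalues i * inner ℝ (hP.eigenvectorBasis i) z ^ 2 := by
    rw [form_apply, ← hP.eigenvectorBasis.sum_inner_mul_inner]
    refine Finset.sum_congr rfl fun i _ => ?_
    have h2 : clm P (hP.eigenvectorBasis i) = hP.eigenvalues i • hP.eigenvectorBasis i := by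
      ext j
      have := congrFun (hP.mulVec_eigenvectorBasis i) j
      simpa [clm_apply, Matrix.toLpLin_apply] using this
    rw [← form_apply, form_comm hP, form_apply, h2, inner_smul_right, real_inner_comm z]
    rw [real_inner_comm (hP.eigenvectorBasis i) z]
    ring
  rw [h1, ← hP.eigenvectorBasis.sum_sq_inner_right z, Finset.mul_sum]
  refine Finset.sum_le_sum fun i _ => ?_
  refine mul_le_mul_of_nonneg_right ?_ (sq_nonneg _)
  rw [lambdaMin, hP.spectrum_real_eq_range_eigenvalues]
  exact csInf_le (Set.finite_range _).bddBelow ⟨i, rfl⟩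

theorem lambdaMin_pos {P : Matrix (Fin n) (Fin n) ℝ} (hP : P.PosDef) (hn : 0 < n) :
    0 < lambdaMin P := by
  have : Nonempty (Fin n) := ⟨⟨0, hn⟩⟩
  rw [lambdaMin, hP.isHermitian.spectrum_real_eq_range_eigenvalues]
  obtain ⟨i, hi⟩ := (Set.range_nonempty hP.isHermitian.eigenvalues).csInf_mem (Set.finite_range _)
  rw [← hi]
  exact hP.eigenvalues_pos i

end Form

/-! ### The matrix inequalities as inequalities between quadratic forms. -/

section LMIForm

variable {n p : ℕ} {A : Matrix (Fin n) (Fin n) ℝ} {B : Matrix (Fin n) (Fin p) ℝ}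
  {τbar τhat δ γ ε : ℝ} {P Q R S S₁₂ M : Matrix (Fin n) (Fin n) ℝ} {Y : Matrix (Fin p) (Fin n) ℝ}

theorem dotProduct_comp_mulVec {ι : Type*} [Fintype ι]
    (Φ : Matrix ι ι (Matrix (Fin n) (Fin n) ℝ)) (x : ι → E n) :
    (fun k : ι × Fin n => x k.1 k.2) ⬝ᵥ
      (Matrix.comp ι ι (Fin n) (Fin n) ℝ Φ).mulVec (fun k => x k.1 k.2)
      = ∑ i, ∑ j, form (Φ i j) (x i) (x j) := by
  simp only [form_eq_dotProduct, dotProduct, Matrix.mulVec, Matrix.comp_apply,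
    Fintype.sum_prod_type, Finset.mul_sum]
  refine Finset.sum_congr rfl fun i _ => ?_
  rw [Finset.sum_comm]

/-- The quadratic form of `Φ₂`. -/
theorem phi2_form (hR : R.IsHermitian) (a b c d w : E n) :
    (fun k : Fin 5 × Fin n => (![a, b, c, d, w] : Fin 5 → E n) k.1 k.2) ⬝ᵥ
      (Phi2 A B τbar τhat δ γ ε P Q R S S₁₂ M Y).mulVec
        (fun k => (![a, b, c, d, w] : Fin 5 → E n) k.1 k.2)
      = 2 * δ * form P a a + 2 * form P a b + form S a a + form Q a a
        - Real.exp (-2 * δ * τbar) * form S c c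
        - (1 - τhat) * Real.exp (-2 * δ * τbar) * form Q d d + τbar ^ 2 * form R b b
        - Real.exp (-2 * δ * τbar) *
          (form R (a - d) (a - d) + 2 * form S₁₂ (a - d) (d - c) + form R (d - c) (d - c))
        - γ * ‖w‖ ^ 2
        + 2 * (form (A * M) a a + form (B * Y) a d + inner ℝ a w - form M a b)
        + 2 * ε * (form (A * M) b a + form (B * Y) b d + inner ℝ b w - form M b b) := by
  unfold Phi2
  rw [dotProduct_comp_mulVec]
  simp only [Fin.sum_univ_five, Matrix.of_apply, Matrix.cons_val, ← Matrix.transpose_mul,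
    form_add, form_sub, form_neg, form_smul, form_transpose, form_zero, form_one, map_sub,
    sub_apply, Matrix.transpose_add, Matrix.transpose_sub, Matrix.transpose_smul,
    Matrix.transpose_transpose, real_inner_self_eq_norm_sq]
  rw [form_comm hR d a, form_comm hR c d, real_inner_comm a w, real_inner_comm b w]
  ring

/-- If `M b = 0`, testing `Φ₂` on the vector with only second block `b` leaves `τbar² bᵀ R b ≥ 0`,
since both terms with `ε` vanish; negative definiteness then forces `b = 0`. -/
theorem LMISolution.isUnit_det (h : LMISolution A B τbar τhat δ γ ε P Q R S S₁₂ M Y) :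
    IsUnit M.det := by
  rw [← Matrix.isUnit_iff_isUnit_det, ← Matrix.mulVec_injective_iff_isUnit]
  refine (injective_iff_map_eq_zero (Matrix.mulVecLin M)).2 fun v hv => ?_
  by_contra hv0
  let b : E n := WithLp.toLp 2 v
  have hx : (fun k : Fin 5 × Fin n => (![0, b, 0, 0, 0] : Fin 5 → E n) k.1 k.2) ≠ 0 := by
    intro h0
    refine hv0 (funext fun i => ?_)
    simpa [b] using congrFun h0 (1, i)
  have h1 := h.phi2_neg.dotProduct_mulVec_pos hx
  rw [star_trivial, Matrix.neg_mulVec, dotProduct_neg, phi2_form h.posDef_R.isHermitian] at h1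
  have hM : form M b b = 0 := by
    rw [form_eq_dotProduct]
    have : M.mulVec v = 0 := hv
    simp [b, this]
  have hR := form_self_nonneg h.posDef_R.posSemidef b
  simp only [hM, map_zero, zero_apply, sub_self, inner_zero_right, norm_zero] at h1
  have : 0 ≤ τbar ^ 2 * form R b b := by positivity
  linarith

/-- Descriptor method: `Φ₂` contains the residual `A M a + B Y d + w - M b` paired with `2a` and
with `2εb`. On solutions the residual is zero, so `a`, `b`, `c`, `d` can stand for `η`, `η̇`, `η(t -
τbar)` and `η(t - τ)`. -/
theorem LMISolution.form_le (h : LMISolution A B τbar τhat δ γ ε P Q R S S₁₂ M Y)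
    {a b c d w : E n} (hb : clm M b = clm (A * M) a + clm (B * Y) d + w) :
    2 * δ * form P a a + 2 * form P a b + form S a a + form Q a a
        - Real.exp (-2 * δ * τbar) * form S c c
        - (1 - τhat) * Real.exp (-2 * δ * τbar) * form Q d d + τbar ^ 2 * form R b b
      ≤ Real.exp (-2 * δ * τbar) *
          (form R (a - d) (a - d) + 2 * form S₁₂ (a - d) (d - c) + form R (d - c) (d - c))
        + γ * ‖w‖ ^ 2 := by
  have h1 := h.phi2_neg.posSemidef.dotProduct_mulVec_nonneg
    (fun k : Fin 5 × Fin n => (![a, b, c, d, w] : Fin 5 → E n) k.1 k.2)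
  rw [star_trivial, Matrix.neg_mulVec, dotProduct_neg, phi2_form h.posDef_R.isHermitian] at h1
  have h2 : ∀ y : E n, form M y b = form (A * M) y a + form (B * Y) y d + inner ℝ y w := by
    intro y
    rw [form_apply, hb, inner_add_right, inner_add_right]
    rfl
  rw [h2 a, h2 b] at h1
  linarith

theorem LMISolution.posSemidef_Q (h : LMISolution A B τbar τhat δ γ ε P Q R S S₁₂ M Y) :
    Q.PosSemidef := by
  rcases lt_or_ge τhat 1 with h1 | h1
  · exact (h.posDef_Q h1).posSemidef
  · rw [h.zero_Q h1]
    exact Matrix.PosSemidef.zero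

theorem LMISolution.posDef_unbar (h : LMISolution A B τbar τhat δ γ ε P Q R S S₁₂ M Y) :
    (unbar P M).PosDef := by
  have h1 := h.posDef_P.conjTranspose_mul_mul_same (B := M⁻¹) (by
    rw [Matrix.mulVec_injective_iff_isUnit]
    exact (Matrix.isUnit_nonsing_inv_iff).2 ((Matrix.isUnit_iff_isUnit_det _).2 h.isUnit_det))
  rwa [Matrix.conjTranspose_eq_transpose_of_trivial] at h1

/-- Reciprocally convex combination. -/
theorem reciprocally_convex (hΦ : (Phi2' R S₁₂).PosSemidef) {a b : E n} {α β X Y : ℝ}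
    (hα : 0 ≤ α) (hβ : 0 ≤ β) (hX : 0 ≤ X) (hY : 0 ≤ Y) (hb : form R b b ≤ α * X)
    (ha : form R a a ≤ β * Y) (hb0 : 0 ≤ form R b b) (ha0 : 0 ≤ form R a a) :
    form R b b + 2 * form S₁₂ b a + form R a a ≤ (α + β) * (X + Y) := by
  have hq : ∀ s : ℝ, 0 ≤ form R b b * (s * s) + 2 * form S₁₂ b a * s + form R a a := by
    intro s
    -- Testing `Φ₂'` on `(s b, a)` gives a nonnegative quadratic polynomial in `s`, whose
    -- discriminant yields `(bᵀ S₁₂ a)² ≤ (bᵀ R b)(aᵀ R a)`.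
    have h1 := hΦ.dotProduct_mulVec_nonneg (Sum.elim (s • b.ofLp) a.ofLp)
    have h2 : star (Sum.elim (s • b.ofLp) a.ofLp) ⬝ᵥ
        (Phi2' R S₁₂).mulVec (Sum.elim (s • b.ofLp) a.ofLp)
        = form R (s • b) (s • b) + form S₁₂ (s • b) a + form S₁₂.transpose a (s • b)
          + form R a a := by
      rw [star_trivial, Phi2', Matrix.fromBlocks_mulVec]
      simp only [form_eq_dotProduct, sumElim_dotProduct_sumElim, dotProduct_add,
        Sum.elim_comp_inl, Sum.elim_comp_inr, WithLp.ofLp_smul]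
      ring
    rw [h2, form_transpose] at h1
    simp only [map_smul, smul_apply, smul_eq_mul] at h1
    linarith
  have hd := discrim_le_zero hq
  rw [discrim] at hd
  have h1 : form S₁₂ b a ^ 2 ≤ (α * X) * (β * Y) := by
    have := mul_le_mul hb ha ha0 (hb0.trans hb)
    nlinarith
  -- Arithmetic-geometric mean after regrouping `(α X)(β Y) = (β X)(α Y)`. This form avoids dividing
  -- by `α` or `β`, so the extreme delays `0` and `τbar` are included.
  have h2 : 2 * form S₁₂ b a ≤ β * X + α * Y := by
    by_contra! hlt
    have h0 : 0 ≤ β * X + α * Y := by positivity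
    nlinarith [sq_nonneg (β * X - α * Y)]
  nlinarith

end LMIForm

/-! ### Jensen's inequality and integrals over delay windows. -/

section Jensen

variable {n : ℕ}

/-- Integrates the nonnegative form of `g - c`, where `c` is the mean of `g` over the interval. -/
theorem form_integral_le {R : Matrix (Fin n) (Fin n) ℝ} (hR : R.PosSemidef) {g : ℝ → E n}
    {a b : ℝ} (hab : a ≤ b) (hg : IntervalIntegrable g volume a b)
    (hq : IntervalIntegrable (fun s => form R (g s) (g s)) volume a b) :
    form R (∫ s in a..b, g s) (∫ s in a..b, g s) ≤ (b - a) * ∫ s in a..b, form R (g s) (g s) := by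
  rcases hab.eq_or_lt with rfl | hlt
  · simp
  set d := ∫ s in a..b, g s with hd
  set c : E n := (b - a)⁻¹ • d with hc
  have hpos : 0 < b - a := sub_pos.2 hlt
  have hlin : IntervalIntegrable (fun s => form R c (g s)) volume a b :=
    ⟨(form R c).integrable_comp hg.1, (form R c).integrable_comp hg.2⟩
  have h1 : 0 ≤ ∫ s in a..b, (form R (g s) (g s) - 2 * form R c (g s) + form R c c) := by
    refine intervalIntegral.integral_nonneg hab fun s _ => ?_
    have h2 := form_self_nonneg hR (g s - c)
    simp only [map_sub, sub_apply] at h2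
    rw [form_comm hR.isHermitian (g s) c] at h2
    linarith
  rw [intervalIntegral.integral_add (hq.sub (hlin.const_mul 2)) (by simp),
    intervalIntegral.integral_sub hq (hlin.const_mul 2), intervalIntegral.integral_const_mul,
    (form R c).intervalIntegral_comp_comm hg, intervalIntegral.integral_const, ← hd, hc] at h1
  simp only [map_smul, smul_apply, smul_eq_mul] at h1
  have h3 : (b - a) * ((b - a)⁻¹ * ((b - a)⁻¹ * form R d d)) = (b - a)⁻¹ * form R d d := by
    field_simp
  rw [h3] at h1
  have h4 : (b - a)⁻¹ * form R d d ≤ ∫ s in a..b, form R (g s) (g s) := by linarith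
  calc form R d d = (b - a) * ((b - a)⁻¹ * form R d d) := by field_simp
    _ ≤ _ := by gcongr

end Jensen

theorem IsPrimitive.const_mul {x f : ℝ → ℝ} (c : ℝ) (h : IsPrimitive x f) :
    IsPrimitive (fun t => c * x t) (fun t => c * f t) := by
  simpa using h.map (c • ContinuousLinearMap.id ℝ ℝ)

/-- The delay of one agent: differentiable, `0 ≤ τ ≤ τbar` and `τ̇ ≤ τhat` on `[0, ∞)`. -/
structure IsInputDelay (τbar τhat : ℝ) (τ : ℝ → ℝ) : Prop where
  nonneg : ∀ t, 0 ≤ t → 0 ≤ τ t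
  le_bar : ∀ t, 0 ≤ t → τ t ≤ τbar
  differentiable : DifferentiableOn ℝ τ (Set.Ici 0)
  deriv_le : ∀ t, 0 ≤ t → derivWithin τ (Set.Ici 0) t ≤ τhat

theorem InputDelays.isInputDelay {N : ℕ} {τbar τhat : ℝ} {τu : Fin N → ℝ → ℝ}
    (h : InputDelays τbar τhat τu) (i : Fin N) : IsInputDelay τbar τhat (τu i) :=
  ⟨h.nonneg i, h.le_bar i, h.differentiable i, h.deriv_le i⟩

theorem hasDerivAt_integral_of_continuous {φ : ℝ → ℝ} (hφ : Continuous φ) (t : ℝ) :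
    HasDerivAt (fun t => ∫ s in (0 : ℝ)..t, φ s) (φ t) t :=
  (hφ.integral_hasStrictDerivAt 0 t).hasDerivAt

/-- Increment of `∫_{t - τ(t)}^t φ`. -/
theorem IsInputDelay.integral_sub_le {τbar τhat : ℝ} {τ φ : ℝ → ℝ} (hτ : IsInputDelay τbar τhat τ)
    (hφ : Continuous φ) (hφ0 : ∀ t, 0 ≤ φ t) {s t : ℝ} (hs : 0 ≤ s) (hst : s ≤ t) :
    ((∫ r in (0 : ℝ)..t, φ r) - ∫ r in (0 : ℝ)..(t - τ t), φ r)
        - ((∫ r in (0 : ℝ)..s, φ r) - ∫ r in (0 : ℝ)..(s - τ s), φ r)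
      ≤ ∫ r in s..t, (φ r - (1 - τhat) * φ (r - τ r)) := by
  have hsub : Set.Icc s t ⊆ Set.Ici 0 := fun r hr => hs.trans hr.1
  have hτc : ContinuousOn τ (Set.Icc s t) := hτ.differentiable.continuousOn.mono hsub
  have hF : Continuous fun t => ∫ r in (0 : ℝ)..t, φ r :=
    continuous_iff_continuousAt.2 fun t => (hasDerivAt_integral_of_continuous hφ t).continuousAt
  -- The derivative of `τ` is assumed bounded only from above, so a one-sided comparison is used:
  -- the derivative `φ(r) - φ(r - τ)(1 - τ̇)` only has to lie below a continuous function, and it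
  -- does because `φ ≥ 0` and `τ̇ ≤ τhat`.
  refine intervalIntegral.sub_le_integral_of_hasDeriv_right_of_le
    (g := fun t => (∫ r in (0 : ℝ)..t, φ r) - ∫ r in (0 : ℝ)..(t - τ t), φ r)
    (g' := fun r => φ r - φ (r - τ r) * (1 - derivWithin τ (Set.Ici 0) r)) hst ?_ ?_ ?_ ?_
  · exact hF.continuousOn.sub (hF.comp_continuousOn (continuousOn_id.sub hτc))
  · intro r hr
    have hr0 : 0 < r := lt_of_le_of_lt hs hr.1
    have h1 : HasDerivAt τ (derivWithin τ (Set.Ici 0) r) r :=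
      ((hτ.differentiable r hr0.le).hasDerivWithinAt).hasDerivAt (Ici_mem_nhds hr0)
    have h2 := (hasDerivAt_integral_of_continuous hφ (r - τ r)).comp r ((hasDerivAt_id r).sub h1)
    exact ((hasDerivAt_integral_of_continuous hφ r).sub h2).hasDerivWithinAt
  · refine ContinuousOn.integrableOn_Icc ?_
    exact hφ.continuousOn.sub (continuousOn_const.mul
      (hφ.comp_continuousOn (continuousOn_id.sub hτc)))
  · intro r hr
    have h1 := hτ.deriv_le r (hs.trans hr.1.le)
    have h2 := hφ0 (r - τ r)
    nlinarith

/-! ### The Lyapunov-Krasovskii functional. -/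

section Lyapunov

variable {n p : ℕ} {A : Matrix (Fin n) (Fin n) ℝ} {B : Matrix (Fin n) (Fin p) ℝ}
  {τbar τhat δ γ ε : ℝ} {P Q R S S₁₂ M : Matrix (Fin n) (Fin n) ℝ} {Y : Matrix (Fin p) (Fin n) ℝ}

theorem form_self_le {n : ℕ} (T : Matrix (Fin n) (Fin n) ℝ) (a : E n) :
    form T a a ≤ ‖form T‖ * ‖a‖ ^ 2 := by
  have := (le_abs_self _).trans ((form T).le_opNorm₂ a a)
  linarith [congrArg (‖form T‖ * ·) (sq ‖a‖), mul_assoc ‖form T‖ ‖a‖ ‖a‖]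

/-- Bound for the double-integral term of the functional. -/
theorem LMISolution.form_le_integral (h : LMISolution A B τbar τhat δ γ ε P Q R S S₁₂ M Y)
    (hδ : 0 < δ) {η g : ℝ → E n}
    (hprim : ∀ a b, IntervalIntegrable g volume a b ∧ η b - η a = ∫ s in a..b, g s)
    (hq : ∀ a b, IntervalIntegrable (fun s => form R (g s) (g s)) volume a b)
    {r θ : ℝ} (hθ0 : 0 ≤ θ) (hθ1 : θ ≤ τbar) :
    Real.exp (2 * δ * r) * (Real.exp (-2 * δ * τbar) *
        (form R (η r - η (r - θ)) (η r - η (r - θ))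
          + 2 * form S₁₂ (η r - η (r - θ)) (η (r - θ) - η (r - τbar))
          + form R (η (r - θ) - η (r - τbar)) (η (r - θ) - η (r - τbar))))
      ≤ τbar * ∫ s in (r - τbar)..r, Real.exp (2 * δ * s) * form R (g s) (g s) := by
  have hR := h.posDef_R.posSemidef
  have h1 := form_integral_le hR (by linarith : r - θ ≤ r) (hprim _ _).1 (hq _ _)
  have h2 := form_integral_le hR (by linarith : r - τbar ≤ r - θ) (hprim _ _).1 (hq _ _)
  rw [← (hprim _ _).2] at h1 h2
  rw [sub_sub_cancel] at h1
  rw [sub_sub_sub_cancel_left] at h2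
  have hX : 0 ≤ ∫ s in (r - θ)..r, form R (g s) (g s) :=
    intervalIntegral.integral_nonneg (by linarith) fun s _ => form_self_nonneg hR _
  have hY : 0 ≤ ∫ s in (r - τbar)..(r - θ), form R (g s) (g s) :=
    intervalIntegral.integral_nonneg (by linarith) fun s _ => form_self_nonneg hR _
  -- The window of length `τbar` is cut at `r - θ`; the two Jensen factors `θ` and `τbar - θ` add up
  -- to `τbar`.
  have h3 := reciprocally_convex h.phi2'_nonneg (α := θ) (β := τbar - θ) hθ0 (by linarith) hX hY
    h1 h2 (form_self_nonneg hR _)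
    (form_self_nonneg hR _)
  rw [add_comm (∫ s in (r - θ)..r, form R (g s) (g s)),
    intervalIntegral.integral_add_adjacent_intervals (hq _ _) (hq _ _)] at h3
  have h4 : Real.exp (2 * δ * r) * Real.exp (-2 * δ * τbar)
      * ∫ s in (r - τbar)..r, form R (g s) (g s)
      ≤ ∫ s in (r - τbar)..r, Real.exp (2 * δ * s) * form R (g s) (g s) := by
    rw [← intervalIntegral.integral_const_mul]
    refine intervalIntegral.integral_mono_on (by linarith) ((hq _ _).const_mul _)
      ((hq _ _).continuousOn_mul (by fun_prop)) fun s hs => ?_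
    refine mul_le_mul_of_nonneg_right ?_ (form_self_nonneg hR _)
    rw [← Real.exp_add, Real.exp_le_exp]
    nlinarith [hs.1]
  have hτ : 0 ≤ τbar := hθ0.trans hθ1
  rw [← mul_assoc]
  calc _ ≤ Real.exp (2 * δ * r) * Real.exp (-2 * δ * τbar) *
        ((θ + (τbar - θ)) * ∫ s in (r - τbar)..r, form R (g s) (g s)) := by gcongr
    _ = τbar * (Real.exp (2 * δ * r) * Real.exp (-2 * δ * τbar)
      * ∫ s in (r - τbar)..r, form R (g s) (g s)) := by ring
    _ ≤ _ := by gcongr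

set_option maxHeartbeats 800000 in
/-- The Lyapunov-Krasovskii functional of the delayed closed loop, in the coordinates
`η = M⁻¹ z`. -/
theorem LMISolution.exists_functional (h : LMISolution A B τbar τhat δ γ ε P Q R S S₁₂ M Y)
    (hτbar : 0 ≤ τbar) (hδ : 0 < δ) (hγ : 0 < γ) {τ : ℝ → ℝ} (hτ : IsInputDelay τbar τhat τ)
    {η g w : ℝ → E n}
    (hprim : ∀ a b, IntervalIntegrable g volume a b ∧ η b - η a = ∫ s in a..b, g s)
    (hneg : ∀ s, s < 0 → g s = 0)
    (hq : ∀ a b, IntervalIntegrable (fun s => form R (g s) (g s)) volume a b)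
    (heq : ∀ᵐ t ∂(volume.restrict (Set.Ici (0 : ℝ))),
      clm M (g t) = clm (A * M) (η t) + clm (B * Y) (η (t - τ t)) + w t) :
    ∃ V : ℝ → ℝ, (∀ t, 0 ≤ t → form P (η t) (η t) ≤ V t) ∧
      V 0 ≤ (‖form P‖ + τbar * ‖form S‖ + τbar * ‖form Q‖) * ‖η 0‖ ^ 2 ∧
      ∀ s t a : ℝ, 0 ≤ s → s ≤ t → (∀ᵐ r ∂(volume.restrict (Set.Icc s t)), ‖w r‖ ≤ a) →
        V t ≤ Real.exp (-(2 * δ) * (t - s)) * V s + γ / (2 * δ) * a ^ 2 := by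
  have hR := h.posDef_R.posSemidef
  have hS := h.posDef_S.posSemidef
  have hQ := h.posSemidef_Q
  have hηc : Continuous η := by
    have h1 : η = fun t => η 0 + ∫ s in (0 : ℝ)..t, g s := by
      funext t
      rw [← (hprim 0 t).2]
      abel
    rw [h1]
    exact continuous_const.add (intervalIntegral.continuous_primitive (fun a b => (hprim a b).1) 0)
  have hη : IsPrimitive η g := fun t _ => ⟨(hprim 0 t).1, by rw [← (hprim 0 t).2]; abel⟩
  have hη0 : ∀ s, s ≤ 0 → η s = η 0 := by
    intro s hs
    have h1 : ∫ r in s..0, g r = 0 := by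
      have : ∀ᵐ r, r ∈ Set.uIoc s 0 → g r = 0 := by
        have hne : ∀ᵐ r : ℝ, r ≠ 0 := by simp [ae_iff, measure_singleton]
        filter_upwards [hne] with r hr hrs
        rw [Set.uIoc_of_le hs] at hrs
        exact hneg r (lt_of_le_of_ne hrs.2 hr)
      exact intervalIntegral.integral_zero_ae this
    have h2 := (hprim s 0).2
    rw [h1, sub_eq_zero] at h2
    exact h2.symm
  let e : ℝ → ℝ := fun s => Real.exp (2 * δ * s)
  have hepos : ∀ s, 0 < e s := fun s => Real.exp_pos _
  have hec : Continuous e := by fun_prop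
  have hqc : ∀ T : Matrix (Fin n) (Fin n) ℝ, Continuous fun s => form T (η s) (η s) := by
    intro T
    fun_prop
  let φS : ℝ → ℝ := fun s => e s * form S (η s) (η s)
  let φQ : ℝ → ℝ := fun s => e s * form Q (η s) (η s)
  have hφS : Continuous φS := hec.mul (hqc S)
  have hφQ : Continuous φQ := hec.mul (hqc Q)
  have hφS0 : ∀ s, 0 ≤ φS s := fun s => mul_nonneg (hepos s).le (form_self_nonneg hS _)
  have hφQ0 : ∀ s, 0 ≤ φQ s := fun s => mul_nonneg (hepos s).le (form_self_nonneg hQ _)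
  let ρ : ℝ → ℝ := fun s => e s * form R (g s) (g s)
  have hρ0 : ∀ s, 0 ≤ ρ s := fun s => mul_nonneg (hepos s).le (form_self_nonneg hR _)
  have hρi : ∀ a b, IntervalIntegrable ρ volume a b := fun a b =>
    (hq a b).continuousOn_mul hec.continuousOn
  let FS : ℝ → ℝ := fun t => ∫ s in (0 : ℝ)..t, φS s
  let FQ : ℝ → ℝ := fun t => ∫ s in (0 : ℝ)..t, φQ s
  let H : ℝ → ℝ := fun t => ∫ s in (0 : ℝ)..t, ρ s
  have hHc : Continuous H := intervalIntegral.continuous_primitive hρi 0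
  let J : ℝ → ℝ := fun t => ∫ s in (0 : ℝ)..t, H s
  have hFS : ∀ a b, FS b - FS a = ∫ s in a..b, φS s := fun a b =>
    intervalIntegral.integral_interval_sub_left (hφS.intervalIntegrable _ _)
      (hφS.intervalIntegrable _ _)
  have hFQ : ∀ a b, FQ b - FQ a = ∫ s in a..b, φQ s := fun a b =>
    intervalIntegral.integral_interval_sub_left (hφQ.intervalIntegrable _ _)
      (hφQ.intervalIntegrable _ _)
  have hH : ∀ a b, H b - H a = ∫ s in a..b, ρ s := fun a b =>
    intervalIntegral.integral_interval_sub_left (hρi _ _) (hρi _ _)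
  have hJ : ∀ a b, J b - J a = ∫ s in a..b, H s := fun a b =>
    intervalIntegral.integral_interval_sub_left (hHc.intervalIntegrable _ _)
      (hHc.intervalIntegrable _ _)
  have hHmono : Monotone H := by
    intro a b hab
    rw [← sub_nonneg, hH]
    exact intervalIntegral.integral_nonneg hab fun s _ => hρ0 s
  -- `τbar H(t) - ∫_{t-τbar}^t H` is the double integral of `ρ` over `t - τbar ≤ s ≤ r ≤ t`, written
  -- through iterated primitives so that its derivative is immediate. The weight `e^{2δs}` absorbs
  -- the decay rate: `V` will be `e^{-2δt} W`. The term with `Q` is kept apart, since only an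
  -- inequality for its increments is available.
  let W₁ : ℝ → ℝ := fun t => e t * form P (η t) (η t) + (FS t - FS (t - τbar))
    + τbar * (τbar * H t - (J t - J (t - τbar)))
  let Ψ₁ : ℝ → ℝ := fun r =>
    (e r * (2 * δ) * form P (η r) (η r) + e r * (form P (g r) (η r) + form P (η r) (g r)))
    + (φS r - φS (r - τbar)) + τbar * (τbar * ρ r - (H r - H (r - τbar)))
  have hW₁ : IsPrimitive W₁ Ψ₁ := by
    have hep : IsPrimitive e fun t => e t * (2 * δ) := by
      refine IsPrimitive.of_hasDerivAt (fun t => ?_) (by fun_prop)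
      simpa [e] using! ((hasDerivAt_id t).const_mul (2 * δ)).exp
    have h1 := hep.mul (hη.bilin (form P) hη)
    have h2 : IsPrimitive (fun t => FS t - FS (t - τbar)) (fun t => φS t - φS (t - τbar)) := by
      refine IsPrimitive.of_hasDerivAt (fun t => ?_) (by fun_prop)
      exact (hasDerivAt_integral_of_continuous hφS t).sub
        ((hasDerivAt_integral_of_continuous hφS (t - τbar)).comp_sub_const t τbar)
    have h3 : IsPrimitive (fun t => J t - J (t - τbar)) (fun t => H t - H (t - τbar)) := by
      refine IsPrimitive.of_hasDerivAt (fun t => ?_) (by fun_prop)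
      exact (hasDerivAt_integral_of_continuous hHc t).sub
        ((hasDerivAt_integral_of_continuous hHc (t - τbar)).comp_sub_const t τbar)
    have h4 : IsPrimitive H ρ := fun t _ => ⟨hρi 0 t, by simp [H]⟩
    exact (h1.add h2).add (((h4.const_mul τbar).sub h3).const_mul τbar)
  let W : ℝ → ℝ := fun t => W₁ t + (FQ t - FQ (t - τ t))
  have hWlow : ∀ t, 0 ≤ t → e t * form P (η t) (η t) ≤ W t := by
    intro t ht
    have h1 : 0 ≤ FS t - FS (t - τbar) := by
      rw [hFS]
      exact intervalIntegral.integral_nonneg (by linarith) fun s _ => hφS0 s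
    have h2 : 0 ≤ FQ t - FQ (t - τ t) := by
      rw [hFQ]
      exact intervalIntegral.integral_nonneg (by linarith [hτ.nonneg t ht]) fun s _ => hφQ0 s
    have h3 : J t - J (t - τbar) ≤ τbar * H t := by
      rw [hJ]
      have := intervalIntegral.integral_mono_on (μ := volume) (a := t - τbar) (b := t) (by linarith)
        (hHc.intervalIntegrable _ _) (intervalIntegrable_const (c := H t))
        (fun s hs => hHmono hs.2)
      simpa using this
    have h4 : 0 ≤ τbar * (τbar * H t - (J t - J (t - τbar))) := mul_nonneg hτbar (by linarith)
    simp only [W, W₁]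
    linarith
  -- Integrating the pointwise bound `Ẇ ≤ γ a² e^{2δr}` over `[s, t]` produces the factor `γ /
  -- (2δ)`.
  have hstep : ∀ s t a : ℝ, 0 ≤ s → s ≤ t →
      (∀ᵐ r ∂(volume.restrict (Set.Icc s t)), ‖w r‖ ≤ a) →
      W t - W s ≤ γ / (2 * δ) * a ^ 2 * (e t - e s) := by
    intro s t a hs hst hw
    have ht : 0 ≤ t := hs.trans hst
    have hsub : Set.Icc s t ⊆ Set.Ici 0 := fun r hr => hs.trans hr.1
    have hτc : ContinuousOn τ (Set.Icc s t) := hτ.differentiable.continuousOn.mono hsub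
    have hintg₂ : IntervalIntegrable (fun r => φQ r - (1 - τhat) * φQ (r - τ r)) volume s t := by
      refine ContinuousOn.intervalIntegrable ?_
      rw [Set.uIcc_of_le hst]
      exact hφQ.continuousOn.sub (continuousOn_const.mul
        (hφQ.comp_continuousOn (continuousOn_id.sub hτc)))
    have h1 := hW₁.sub_eq hs ht
    have h2 : (FQ t - FQ (t - τ t)) - (FQ s - FQ (s - τ s))
        ≤ ∫ r in s..t, (φQ r - (1 - τhat) * φQ (r - τ r)) := hτ.integral_sub_le hφQ hφQ0 hs hst
    have hexp : ∫ r in s..t, γ * a ^ 2 * e r = γ / (2 * δ) * a ^ 2 * (e t - e s) := by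
      rw [intervalIntegral.integral_const_mul]
      have h3 : ∫ r in s..t, e r * (2 * δ) = e t - e s := by
        refine intervalIntegral.integral_eq_sub_of_hasDerivAt (fun r _ => ?_)
          ((hec.mul continuous_const).intervalIntegrable _ _)
        simpa [e] using! ((hasDerivAt_id r).const_mul (2 * δ)).exp
      rw [intervalIntegral.integral_mul_const] at h3
      rw [← h3]
      field_simp
    have h3 : ∫ r in s..t, (Ψ₁ r + (φQ r - (1 - τhat) * φQ (r - τ r)))
        ≤ ∫ r in s..t, γ * a ^ 2 * e r := by
      refine intervalIntegral.integral_mono_ae_restrict hst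
        ((hW₁.intervalIntegrable hs ht).add hintg₂)
        ((continuous_const.mul hec).intervalIntegrable _ _) ?_
      filter_upwards [hw, ae_restrict_of_ae_restrict_of_subset hsub heq,
        ae_restrict_mem measurableSet_Icc] with r hwr heqr hr
      have hr0 : 0 ≤ r := hsub hr
      have hθ0 := hτ.nonneg r hr0
      have hθ1 := hτ.le_bar r hr0
      have k1 := h.form_le (c := η (r - τbar)) heqr
      have k2 := h.form_le_integral hδ hprim hq (r := r) hθ0 hθ1
      have k3 : H r - H (r - τbar)
          = ∫ s in (r - τbar)..r, Real.exp (2 * δ * s) * form R (g s) (g s) := hH _ _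
      rw [← k3] at k2
      have k4 : φS (r - τbar)
          = e r * (Real.exp (-2 * δ * τbar) * form S (η (r - τbar)) (η (r - τbar))) := by
        simp only [φS, e]
        rw [← mul_assoc, ← Real.exp_add]
        ring_nf
      -- For `τhat < 1` the weight is smallest at the far end of the window. For `τhat ≥ 1` the
      -- coefficient is nonpositive and this comparison of weights would go the wrong way, but then
      -- `Q = 0`.
      have k5 : e r * ((1 - τhat) * Real.exp (-2 * δ * τbar)
          * form Q (η (r - τ r)) (η (r - τ r))) ≤ (1 - τhat) * φQ (r - τ r) := by
        rcases lt_or_ge τhat 1 with hlt | hge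
        · have k6 : e r * Real.exp (-2 * δ * τbar) ≤ e (r - τ r) := by
            simp only [e]
            rw [← Real.exp_add, Real.exp_le_exp]
            nlinarith
          have k7 := form_self_nonneg hQ (η (r - τ r))
          have k8 : 0 ≤ 1 - τhat := by linarith
          calc _ = (1 - τhat) * ((e r * Real.exp (-2 * δ * τbar))
                * form Q (η (r - τ r)) (η (r - τ r))) := by ring
            _ ≤ _ := by
              simp only [φQ]
              gcongr
        · simp only [φQ, h.zero_Q hge, form_zero]
          simp
      have k9 : ‖w r‖ ^ 2 ≤ a ^ 2 := by gcongr
      have k10 : form P (g r) (η r) = form P (η r) (g r) := form_comm h.posDef_P.isHermitian _ _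
      have k11 := mul_le_mul_of_nonneg_left k1 (hepos r).le
      have k12 : e r * (γ * ‖w r‖ ^ 2) ≤ γ * a ^ 2 * e r := by
        have := mul_le_mul_of_nonneg_left k9 (mul_nonneg hγ.le (hepos r).le)
        linarith
      simp only [Ψ₁, k10, k4]
      simp only [ρ, φQ, φS] at k5 ⊢
      simp only [e] at *
      linarith
    rw [intervalIntegral.integral_add (hW₁.intervalIntegrable hs ht) hintg₂, hexp] at h3
    simp only [W]
    linarith
  refine ⟨fun t => Real.exp (-(2 * δ) * t) * W t, fun t ht => ?_, ?_, fun s t a hs hst hw => ?_⟩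
  · have h1 : Real.exp (-(2 * δ) * t) * e t = 1 := by
      simp only [e]
      rw [← Real.exp_add]
      simp
    calc form P (η t) (η t) = Real.exp (-(2 * δ) * t) * (e t * form P (η t) (η t)) := by
          rw [← mul_assoc, h1, one_mul]
      _ ≤ _ := mul_le_mul_of_nonneg_left (hWlow t ht) (Real.exp_pos _).le
  · have he1 : ∀ s, s ≤ 0 → e s ≤ 1 := fun s hs => Real.exp_le_one_iff.2 (by nlinarith)
    have hintg : ∀ (T : Matrix (Fin n) (Fin n) ℝ), T.PosSemidef → ∀ θ, 0 ≤ θ → θ ≤ τbar →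
        ∫ s in (0 - θ)..0, e s * form T (η s) (η s) ≤ τbar * ‖form T‖ * ‖η 0‖ ^ 2 := by
      intro T hT θ h0 h1
      have h2 := intervalIntegral.integral_mono_on (μ := volume) (a := 0 - θ) (b := 0) (by linarith)
        (f := fun s => e s * form T (η s) (η s)) ((hec.mul (hqc T)).intervalIntegrable _ _)
        (intervalIntegrable_const (c := ‖form T‖ * ‖η 0‖ ^ 2)) (fun s hs => by
          rw [hη0 s hs.2]
          have h3 := form_self_le T (η 0)
          have h4 := form_self_nonneg hT (η 0)
          nlinarith [he1 s hs.2, hepos s])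
      simp only [intervalIntegral.integral_const, sub_sub_cancel, smul_eq_mul] at h2
      refine h2.trans ?_
      rw [mul_assoc]
      gcongr
    -- The constant history has zero derivative, so the double integral vanishes at time `0` and `V
    -- 0` is controlled by `‖η 0‖` alone.
    have hH0 : ∀ s, s ≤ 0 → H s = 0 := by
      intro s hs
      have h1 : ∫ r in s..0, ρ r = 0 := by
        refine intervalIntegral.integral_zero_ae ?_
        have hne : ∀ᵐ r : ℝ, r ≠ 0 := by simp [ae_iff, measure_singleton]
        filter_upwards [hne] with r hr hrs
        rw [Set.uIoc_of_le hs] at hrs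
        simp [ρ, hneg r (lt_of_le_of_ne hrs.2 hr)]
      simp only [H]
      rw [intervalIntegral.integral_symm, h1, neg_zero]
    have hJ0 : J 0 - J (0 - τbar) = 0 := by
      rw [hJ]
      refine intervalIntegral.integral_zero_ae (Eventually.of_forall fun r hr => ?_)
      rw [Set.uIoc_of_le (by linarith)] at hr
      exact hH0 r hr.2
    have h1 := hintg S hS τbar hτbar le_rfl
    have h2 := hintg Q hQ (τ 0) (hτ.nonneg 0 le_rfl) (hτ.le_bar 0 le_rfl)
    have h3 : FS 0 - FS (0 - τbar) ≤ τbar * ‖form S‖ * ‖η 0‖ ^ 2 := by rw [hFS]; exact h1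
    have h4 : FQ 0 - FQ (0 - τ 0) ≤ τbar * ‖form Q‖ * ‖η 0‖ ^ 2 := by rw [hFQ]; exact h2
    have h5 := form_self_le P (η 0)
    have h6 : e 0 = 1 := by simp [e]
    simp only [W, W₁, hJ0, hH0 0 le_rfl, h6, mul_zero, Real.exp_zero, one_mul, sub_self, add_zero]
    linarith
  · have h1 := hstep s t a hs hst hw
    have h2 : Real.exp (-(2 * δ) * t) * (e t - e s) ≤ 1 := by
      have h3 : Real.exp (-(2 * δ) * t) * e t = 1 := by
        simp only [e]
        rw [← Real.exp_add]
        simp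
      have h4 := mul_pos (Real.exp_pos (-(2 * δ) * t)) (hepos s)
      linarith
    have h3 : Real.exp (-(2 * δ) * t) * W s
        = Real.exp (-(2 * δ) * (t - s)) * (Real.exp (-(2 * δ) * s) * W s) := by
      rw [← mul_assoc, ← Real.exp_add]
      ring_nf
    calc Real.exp (-(2 * δ) * t) * W t
        ≤ Real.exp (-(2 * δ) * t) * (W s + γ / (2 * δ) * a ^ 2 * (e t - e s)) := by
          exact mul_le_mul_of_nonneg_left (by linarith) (Real.exp_pos _).le
      _ = Real.exp (-(2 * δ) * t) * W s
          + γ / (2 * δ) * a ^ 2 * (Real.exp (-(2 * δ) * t) * (e t - e s)) := by ring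
      _ ≤ Real.exp (-(2 * δ) * t) * W s + γ / (2 * δ) * a ^ 2 * 1 :=
          add_le_add_right (mul_le_mul_of_nonneg_left h2 (by positivity)) _
      _ = _ := by rw [h3, mul_one]

end Lyapunov

/-! ### Estimates for one delayed system with disturbance. -/

section StateEstimates

variable {n p : ℕ} {A : Matrix (Fin n) (Fin n) ℝ} {B : Matrix (Fin n) (Fin p) ℝ}
  {τbar τhat δ γ ε : ℝ} {P Q R S S₁₂ M : Matrix (Fin n) (Fin n) ℝ}
  {Y K : Matrix (Fin p) (Fin n) ℝ}

theorem clm_mul_apply {m n l : ℕ} (A : Matrix (Fin m) (Fin n) ℝ) (B : Matrix (Fin n) (Fin l) ℝ)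
    (v : E l) : clm (A * B) v = clm A (clm B v) :=
  toEuclideanLin_mul_apply A B v

theorem clm_one_apply {n : ℕ} (v : E n) : clm (1 : Matrix (Fin n) (Fin n) ℝ) v = v := by
  ext i
  simp [clm_apply]

/-- `z` satisfies `ż = A z + F z(t - τ) + w`, where `z` is extended by `z 0` to negative times, and
`w` is essentially bounded. -/
structure IsDelayTrajectory (A F : Matrix (Fin n) (Fin n) ℝ) (τ : ℝ → ℝ) (z w : ℝ → E n) :
    Prop where
  isPrimitive : IsPrimitive z fun t => clm A (z t) + clm F (z (max (t - τ t) 0)) + w t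
  bounded : ∃ C, ∀ᵐ t ∂(volume.restrict (Set.Ici (0 : ℝ))), ‖w t‖ ≤ C

/-- Extension of a primitive by a constant to negative times. -/
theorem IsPrimitive.extend {x f : ℝ → E n} (h : IsPrimitive x f) (a b : ℝ) :
    IntervalIntegrable (fun t => if t < 0 then 0 else f t) volume a b ∧
      x (max b 0) - x (max a 0) = ∫ s in a..b, (if s < 0 then 0 else f s) := by
  have key : ∀ t, IntervalIntegrable (fun t => if t < 0 then 0 else f t) volume 0 t ∧
      x (max t 0) = x 0 + ∫ s in (0 : ℝ)..t, (if s < 0 then 0 else f s) := by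
    intro t
    rcases le_total 0 t with ht | ht
    · have h1 : IsPrimitive x fun t => if t < 0 then 0 else f t :=
        h.congr_right fun t ht => by simp [not_lt.2 ht]
      rw [max_eq_left ht]
      exact h1 t ht
    · have h1 : ∀ᵐ s, s ∈ Set.uIoc 0 t → (if s < 0 then 0 else f s) = 0 := by
        have hne : ∀ᵐ r : ℝ, r ≠ 0 := by simp [ae_iff, measure_singleton]
        filter_upwards [hne] with r hr hrs
        rw [Set.uIoc_of_ge ht] at hrs
        simp [lt_of_le_of_ne hrs.2 hr]
      rw [max_eq_right ht, intervalIntegral.integral_zero_ae h1, add_zero]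
      refine ⟨?_, rfl⟩
      have h2 : (fun _ : ℝ => (0 : E n)) =ᵐ[volume.restrict (Set.uIoc 0 t)]
          fun s => if s < 0 then 0 else f s := by
        rw [Filter.EventuallyEq, ae_restrict_iff' measurableSet_uIoc]
        filter_upwards [h1] with s hs hst
        exact (hs hst).symm
      exact (intervalIntegrable_const (c := (0 : E n))).congr_ae h2
  refine ⟨(key a).1.symm.trans (key b).1, ?_⟩
  rw [(key a).2, (key b).2, add_sub_add_left_eq_sub,
    intervalIntegral.integral_interval_sub_left (key b).1 (key a).1]

/-- The change of variables `η = M⁻¹ z` turns `B K z` into `B Y η` and `P` into `unbar P M`. The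
constant depends on neither the delay nor the trajectory, as uniform bounds require. -/
theorem LMISolution.exists_state_functional
    (h : LMISolution A B τbar τhat δ γ ε P Q R S S₁₂ M Y) (hK : K = Y * M⁻¹)
    (hτbar : 0 ≤ τbar) (hδ : 0 < δ) (hγ : 0 < γ) :
    ∃ c : ℝ, 0 ≤ c ∧ ∀ τ : ℝ → ℝ, IsInputDelay τbar τhat τ → ∀ z w : ℝ → E n,
      IsDelayTrajectory A (B * K) τ z w →
      ∃ V : ℝ → ℝ, (∀ t, 0 ≤ t → form (unbar P M) (z t) (z t) ≤ V t) ∧ V 0 ≤ c * ‖z 0‖ ^ 2 ∧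
        ∀ s t a : ℝ, 0 ≤ s → s ≤ t → (∀ᵐ r ∂(volume.restrict (Set.Icc s t)), ‖w r‖ ≤ a) →
          V t ≤ Real.exp (-(2 * δ) * (t - s)) * V s + γ / (2 * δ) * a ^ 2 := by
  set c₀ := ‖form P‖ + τbar * ‖form S‖ + τbar * ‖form Q‖ with hc₀
  have hc₀0 : 0 ≤ c₀ := by positivity
  refine ⟨c₀ * ‖clm M⁻¹‖ ^ 2, by positivity, fun τ hτ z w hz => ?_⟩
  obtain ⟨C, hC⟩ := hz.bounded
  have hMM : ∀ v, clm M (clm M⁻¹ v) = v := by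
    intro v
    rw [← clm_mul_apply, Matrix.mul_nonsing_inv _ h.isUnit_det, clm_one_apply]
  let f : ℝ → E n := fun t => clm A (z t) + clm (B * K) (z (max (t - τ t) 0)) + w t
  let η : ℝ → E n := fun t => clm M⁻¹ (z (max t 0))
  let g : ℝ → E n := fun t => if t < 0 then 0 else clm M⁻¹ (f t)
  have hprim : ∀ a b, IntervalIntegrable g volume a b ∧ η b - η a = ∫ s in a..b, g s :=
    (hz.isPrimitive.map (clm M⁻¹)).extend
  -- Essential boundedness of `w` makes `η̇` locally bounded; mere local integrability would not
  -- make the quadratic term with `R` integrable.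
  have hbdd : ∀ T, 0 ≤ T → ∃ C', 0 ≤ C' ∧ ∀ᵐ t, t ≤ T → ‖g t‖ ≤ C' := by
    intro T hT
    obtain ⟨Z, hZ⟩ := isCompact_Icc.exists_bound_of_continuousOn
      (hz.isPrimitive.continuousOn.mono (s := Set.Ici (0 : ℝ)) (t := Set.Icc 0 T) fun s hs => hs.1)
    have hZ0 : 0 ≤ Z := (norm_nonneg _).trans (hZ 0 ⟨le_rfl, hT⟩)
    refine ⟨‖clm M⁻¹‖ * (‖clm A‖ * Z + ‖clm (B * K)‖ * Z + max C 0), by positivity, ?_⟩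
    rw [ae_restrict_iff' measurableSet_Ici] at hC
    filter_upwards [hC] with t ht htT
    by_cases ht0 : t < 0
    · simp only [g, ht0, if_true, norm_zero]
      positivity
    · have ht0' : 0 ≤ t := not_lt.1 ht0
      simp only [g, ht0, if_false]
      refine ((clm M⁻¹).le_opNorm _).trans (mul_le_mul_of_nonneg_left ?_ (norm_nonneg _))
      refine (norm_add₃_le).trans ?_
      have h1 := hZ t ⟨ht0', htT⟩
      have h2 := hZ (max (t - τ t) 0) ⟨le_max_right _ _, max_le
        (by linarith [hτ.nonneg t ht0']) hT⟩
      have h3 := (ht ht0').trans (le_max_left C 0)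
      have h4 := ((clm A).le_opNorm (z t)).trans (mul_le_mul_of_nonneg_left h1 (norm_nonneg _))
      have h5 := ((clm (B * K)).le_opNorm (z (max (t - τ t) 0))).trans
        (mul_le_mul_of_nonneg_left h2 (norm_nonneg _))
      linarith
  have hq : ∀ a b, IntervalIntegrable (fun s => form R (g s) (g s)) volume a b := by
    intro a b
    obtain ⟨C', hC'0, hC'⟩ := hbdd (max |a| |b|) (le_max_of_le_left (abs_nonneg a))
    have hg := (hprim a b).1
    have hgm : AEStronglyMeasurable g (volume.restrict (Set.uIoc a b)) :=
      (intervalIntegrable_iff.1 hg).aestronglyMeasurable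
    refine (hg.norm.const_mul (‖form R‖ * C')).mono_fun'
      ((form R).aestronglyMeasurable_comp₂ hgm hgm) ?_
    rw [Filter.EventuallyLE, ae_restrict_iff' measurableSet_uIoc]
    filter_upwards [hC'] with s hs hsab
    have hsT : s ≤ max |a| |b| := by
      refine (hsab.2).trans (max_le_max (le_abs_self a) (le_abs_self b))
    calc ‖form R (g s) (g s)‖ ≤ ‖form R‖ * ‖g s‖ * ‖g s‖ := (form R).le_opNorm₂ _ _
      _ ≤ ‖form R‖ * C' * ‖g s‖ := by
        gcongr
        exact hs hsT
  obtain ⟨V, hV1, hV2, hV3⟩ := h.exists_functional hτbar hδ hγ hτ (w := w) hprim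
    (fun s hs => by simp [g, hs]) hq (by
      filter_upwards [ae_restrict_mem measurableSet_Ici] with t ht
      have ht0 : ¬ t < 0 := not_lt.2 ht
      have hmax : max t 0 = t := max_eq_left ht
      simp only [g, ht0, if_false, η, hMM, hmax, f, hK, clm_mul_apply])
  refine ⟨V, fun t ht => ?_, ?_, hV3⟩
  · have h1 := hV1 t ht
    simp only [η, max_eq_left ht] at h1
    rwa [form_unbar]
  · refine hV2.trans ?_
    have h1 : ‖η 0‖ ≤ ‖clm M⁻¹‖ * ‖z 0‖ := by
      simp only [η, max_self]
      exact (clm M⁻¹).le_opNorm _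
    calc c₀ * ‖η 0‖ ^ 2 ≤ c₀ * (‖clm M⁻¹‖ * ‖z 0‖) ^ 2 := by gcongr
      _ = _ := by ring

theorem exists_pos_mul_norm_sq_le {P : Matrix (Fin n) (Fin n) ℝ} (hP : P.PosDef) :
    ∃ l : ℝ, 0 < l ∧ ∀ z : E n, l * ‖z‖ ^ 2 ≤ form P z z := by
  rcases Nat.eq_zero_or_pos n with rfl | hn
  · exact ⟨1, one_pos, fun z => by simp [Subsingleton.elim z 0]⟩
  · exact ⟨_, lambdaMin_pos hP hn, lambdaMin_mul_norm_sq_le hP.isHermitian⟩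

theorem le_of_mul_sq_le_mul_sq {l k x y : ℝ} (hl : 0 < l) (hk : 0 ≤ k) (hy : 0 ≤ y)
    (h : l * x ^ 2 ≤ k * y ^ 2) : x ≤ Real.sqrt (k / l) * y := by
  refine le_of_sq_le_sq ?_ (by positivity)
  rw [mul_pow, Real.sq_sqrt (by positivity)]
  rw [div_mul_eq_mul_div, le_div_iff₀ hl]
  linarith

/-- Bounded disturbances produce bounded states, exponentially decaying ones produce
exponentially decaying states. -/
theorem LMISolution.exists_state_bound
    (h : LMISolution A B τbar τhat δ γ ε P Q R S S₁₂ M Y) (hK : K = Y * M⁻¹)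
    (hτbar : 0 ≤ τbar) (hδ : 0 < δ) (hγ : 0 < γ) :
    ∃ c : ℝ, 0 ≤ c ∧ ∀ τ : ℝ → ℝ, IsInputDelay τbar τhat τ → ∀ z w : ℝ → E n,
      IsDelayTrajectory A (B * K) τ z w →
      (∀ a : ℝ, 0 ≤ a → (∀ᵐ t ∂(volume.restrict (Set.Ici (0 : ℝ))), ‖w t‖ ≤ a) →
        ∀ t, 0 ≤ t → ‖z t‖ ≤ c * (‖z 0‖ + a)) ∧
      ∀ a κ : ℝ, 0 < κ → 0 ≤ a → ‖z 0‖ ≤ a →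
        (∀ᵐ t ∂(volume.restrict (Set.Ici (0 : ℝ))), ‖w t‖ ≤ a * Real.exp (-κ * t)) →
        ∀ t, 0 ≤ t → ‖z t‖ ≤ c * a * Real.exp (-(min κ δ / 2) * t) := by
  obtain ⟨c, hc, hfun⟩ := h.exists_state_functional hK hτbar hδ hγ
  obtain ⟨l, hl, hlow⟩ := exists_pos_mul_norm_sq_le h.posDef_unbar
  set q := γ / (2 * δ) with hq
  have hq0 : 0 < q := by positivity
  -- The decay estimate costs `c + q` for the value of `V` at `t / 2` and another `q` for the
  -- disturbance on `[t / 2, t]`.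
  refine ⟨Real.sqrt ((c + 2 * q) / l), by positivity, fun τ hτ z w hz => ?_⟩
  obtain ⟨V, hV1, hV2, hV3⟩ := hfun τ hτ z w hz
  have hV0 : ∀ t, 0 ≤ t → 0 ≤ V t := fun t ht =>
    ((form_self_nonneg h.posDef_unbar.posSemidef (z t)).trans (hV1 t ht))
  have hbound : ∀ a : ℝ, (∀ᵐ t ∂(volume.restrict (Set.Ici (0 : ℝ))), ‖w t‖ ≤ a) →
      ∀ t, 0 ≤ t → V t ≤ c * ‖z 0‖ ^ 2 + q * a ^ 2 := by
    intro a ha t ht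
    have h1 := hV3 0 t a le_rfl ht
      (ae_restrict_of_ae_restrict_of_subset (fun r hr => hr.1) ha)
    have h2 : Real.exp (-(2 * δ) * (t - 0)) ≤ 1 := Real.exp_le_one_iff.2 (by nlinarith)
    have h3 := mul_le_of_le_one_left (hV0 0 le_rfl) h2
    linarith
  constructor
  · intro a ha hw t ht
    refine le_of_mul_sq_le_mul_sq hl (by positivity) (by positivity) ?_
    have h1 := (hlow (z t)).trans ((hV1 t ht).trans (hbound a hw t ht))
    have h2 := norm_nonneg (z 0)
    have h3 : ‖z 0‖ ^ 2 ≤ (‖z 0‖ + a) ^ 2 := by gcongr; linarith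
    have h4 : a ^ 2 ≤ (‖z 0‖ + a) ^ 2 := by gcongr; linarith
    have h5 := mul_le_mul_of_nonneg_left h3 hc
    have h6 := mul_le_mul_of_nonneg_left h4 hq0.le
    have h7 : 0 ≤ q * (‖z 0‖ + a) ^ 2 := by positivity
    linarith
  · intro a κ hκ ha hz0 hw t ht
    rw [mul_assoc]
    refine le_of_mul_sq_le_mul_sq hl (by positivity) (by positivity) ?_
    have hw0 : ∀ᵐ t ∂(volume.restrict (Set.Ici (0 : ℝ))), ‖w t‖ ≤ a := by
      filter_upwards [hw, ae_restrict_mem measurableSet_Ici] with r hr hr0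
      have hr0 : (0 : ℝ) ≤ r := hr0
      exact hr.trans (mul_le_of_le_one_right ha (Real.exp_le_one_iff.2 (by nlinarith)))
    -- Splitting at `t / 2`: up to there `V` is merely bounded, and afterwards it is damped by
    -- `e^{-δt}` while the disturbance is at most `a e^{-κt/2}`, whose square is `a² e^{-κt}`. Hence
    -- the rate `min κ δ` for `‖z‖²` and half of it for `‖z‖`.
    have h1 := hbound a hw0 (t / 2) (by positivity)
    have h2 := hV3 (t / 2) t (a * Real.exp (-κ * (t / 2))) (by positivity) (by linarith) (by
      filter_upwards [ae_restrict_of_ae_restrict_of_subset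
        (fun r (hr : r ∈ Set.Icc (t / 2) t) => (by linarith [hr.1] : 0 ≤ r)) hw,
        ae_restrict_mem measurableSet_Icc] with r hr hr0
      refine hr.trans (mul_le_mul_of_nonneg_left (Real.exp_le_exp.2 ?_) ha)
      nlinarith [hr0.1])
    have hmin1 := min_le_left κ δ
    have hmin2 := min_le_right κ δ
    set x := Real.exp (-(min κ δ) * t) with hx
    have h3 : Real.exp (-(2 * δ) * (t - t / 2)) ≤ x := Real.exp_le_exp.2 (by nlinarith)
    have h4 : (a * Real.exp (-κ * (t / 2))) ^ 2 ≤ a ^ 2 * x := by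
      rw [mul_pow, ← Real.exp_nat_mul]
      gcongr
      rw [hx, Real.exp_le_exp]
      push_cast
      nlinarith
    have h5 : (a * Real.exp (-(min κ δ / 2) * t)) ^ 2 = a ^ 2 * x := by
      rw [mul_pow, ← Real.exp_nat_mul, hx]
      congr 2
      push_cast
      ring
    have h6 : V (t / 2) ≤ (c + q) * a ^ 2 := by
      have : ‖z 0‖ ^ 2 ≤ a ^ 2 := by gcongr
      nlinarith
    have h7 : Real.exp (-(2 * δ) * (t - t / 2)) * V (t / 2) ≤ x * ((c + q) * a ^ 2) :=
      mul_le_mul h3 h6 (hV0 _ (by positivity)) (Real.exp_pos _).le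
    have h8 := mul_le_mul_of_nonneg_left h4 hq0.le
    rw [h5]
    have h9 := (hlow (z t)).trans (hV1 t ht)
    linarith

/-- Ultimate bound for the state in terms of the eventual size of the disturbance. -/
theorem LMISolution.eventually_form_le
    (h : LMISolution A B τbar τhat δ γ ε P Q R S S₁₂ M Y) (hK : K = Y * M⁻¹)
    (hτbar : 0 ≤ τbar) (hδ : 0 < δ) (hγ : 0 < γ) {τ : ℝ → ℝ} (hτ : IsInputDelay τbar τhat τ)
    {z w : ℝ → E n} (hz : IsDelayTrajectory A (B * K) τ z w) {a : ℝ}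
    (hw : ∀ η : ℝ, 0 < η → ∃ T, ∀ᵐ t ∂(volume.restrict (Set.Ici T)), ‖w t‖ ≤ a + η)
    {η : ℝ} (hη : 0 < η) :
    ∀ᶠ t in atTop, form (unbar P M) (z t) (z t) ≤ γ / (2 * δ) * a ^ 2 + η := by
  obtain ⟨c, hc, hfun⟩ := h.exists_state_functional hK hτbar hδ hγ
  obtain ⟨V, hV1, hV2, hV3⟩ := hfun τ hτ z w hz
  have hcont : Tendsto (fun s : ℝ => γ / (2 * δ) * (a + s) ^ 2) (𝓝[>] 0)
      (𝓝 (γ / (2 * δ) * (a + 0) ^ 2)) := by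
    have : Continuous fun s : ℝ => γ / (2 * δ) * (a + s) ^ 2 := by fun_prop
    exact (this.tendsto 0).mono_left nhdsWithin_le_nhds
  -- Half of `η` pays for enlarging `a` to `a + s`, the other half for the remaining transient of
  -- `V`.
  obtain ⟨s, hs1, hs2⟩ := ((hcont.eventually_lt_const
    (u := γ / (2 * δ) * a ^ 2 + η / 2) (by rw [add_zero]; linarith)).and
    self_mem_nhdsWithin).exists
  obtain ⟨T, hT⟩ := hw s hs2
  set T' := max T 0 with hT'
  have hlim : Tendsto (fun t : ℝ => Real.exp (-(2 * δ) * (t - T')) * V T') atTop (𝓝 0) := by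
    have h1 : Tendsto (fun t : ℝ => (2 * δ) * (t - T')) atTop atTop :=
      (tendsto_atTop_add_const_right _ _ tendsto_id).const_mul_atTop (by positivity)
    have h2 := (Real.tendsto_exp_neg_atTop_nhds_zero.comp h1).mul_const (V T')
    rw [zero_mul] at h2
    refine h2.congr fun t => ?_
    simp [Function.comp]
  filter_upwards [hlim.eventually_lt_const (u := η / 2) (by positivity), eventually_ge_atTop T']
    with t ht1 ht2
  have h1 := hV3 T' t (a + s) (le_max_right _ _) ht2
    (ae_restrict_of_ae_restrict_of_subset (fun r hr => (le_max_left T 0).trans hr.1) hT)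
  have h2 := hV1 t ((le_max_right T 0).trans ht2)
  linarith

theorem lambdaMin_nonneg {P : Matrix (Fin n) (Fin n) ℝ} (hP : P.PosDef) : 0 ≤ lambdaMin P := by
  rw [lambdaMin, hP.isHermitian.spectrum_real_eq_range_eigenvalues]
  refine Real.sInf_nonneg ?_
  rintro _ ⟨i, rfl⟩
  exact (hP.eigenvalues_pos i).le

theorem LMISolution.eventually_norm_sq_le
    (h : LMISolution A B τbar τhat δ γ ε P Q R S S₁₂ M Y) (hK : K = Y * M⁻¹)
    (hτbar : 0 ≤ τbar) (hδ : 0 < δ) (hγ : 0 < γ) {τ : ℝ → ℝ} (hτ : IsInputDelay τbar τhat τ)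
    {z w : ℝ → E n} (hz : IsDelayTrajectory A (B * K) τ z w) {a : ℝ}
    (hw : ∀ η : ℝ, 0 < η → ∃ T, ∀ᵐ t ∂(volume.restrict (Set.Ici T)), ‖w t‖ ≤ a + η)
    {η : ℝ} (hη : 0 < η) :
    ∀ᶠ t in atTop, ‖z t‖ ^ 2 ≤ γ / (2 * δ * lambdaMin (unbar P M)) * a ^ 2 + η := by
  rcases Nat.eq_zero_or_pos n with rfl | hn
  -- In dimension zero the spectrum is empty and `lambdaMin` takes the default value `0`; the state
  -- is zero, so nonnegativity of the right-hand side suffices.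
  · refine Eventually.of_forall fun t => ?_
    have := lambdaMin_nonneg h.posDef_unbar
    rw [Subsingleton.elim (z t) 0, norm_zero, zero_pow two_ne_zero]
    positivity
  · have hl := lambdaMin_pos h.posDef_unbar hn
    filter_upwards [h.eventually_form_le hK hτbar hδ hγ hτ hz hw (mul_pos hl hη)] with t ht
    have h1 := (lambdaMin_mul_norm_sq_le h.posDef_unbar.isHermitian (z t)).trans ht
    have h2 : γ / (2 * δ * lambdaMin (unbar P M)) * a ^ 2 + η
        = (γ / (2 * δ) * a ^ 2 + lambdaMin (unbar P M) * η) / lambdaMin (unbar P M) := by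
      field_simp
    rw [h2, le_div_iff₀ hl]
    linarith

end StateEstimates

/-! ### Error equations of the closed loops. -/

section ClosedLoop

variable {N : ℕ} {G : Digraph (Fin (N + 1))} {ϵ τbar τhat τcbar : ℝ} {τu : Fin N → ℝ → ℝ}
  {τc : Fin N → Fin (N + 1) → ℝ → ℝ}

theorem EssBoundedBy.nonneg {n : ℕ} {v : ℝ → E n} {Δ : ℝ} (h : EssBoundedBy v Δ) : 0 ≤ Δ := by
  have : (ae (volume.restrict (Set.Ici (0 : ℝ)))).NeBot := by
    rw [ae_restrict_neBot]
    simp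
  obtain ⟨t, ht⟩ := h.2.exists
  exact (norm_nonneg _).trans ht

theorem norm_clm_apply_le {m n : ℕ} (A : Matrix (Fin m) (Fin n) ℝ) {v : E n} {a : ℝ}
    (h : ‖v‖ ≤ a) : ‖clm A v‖ ≤ ‖clm A‖ * a :=
  ((clm A).le_opNorm v).trans (mul_le_mul_of_nonneg_left h (norm_nonneg _))

theorem le_mul_exp_mul_exp {x κ t : ℝ} (hx : 0 ≤ x) (hκ : 0 ≤ κ) (ht : t ≤ τbar) :
    x ≤ x * Real.exp (κ * τbar) * Real.exp (-κ * t) := by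
  rw [mul_assoc, ← Real.exp_add]
  exact le_mul_of_one_le_right hx (Real.one_le_exp (by nlinarith))

theorem exp_neg_mul_sub_le {κ t θ : ℝ} (hκ : 0 ≤ κ) (hθ : θ ≤ τbar) :
    Real.exp (-κ * (t - θ)) ≤ Real.exp (κ * τbar) * Real.exp (-κ * t) := by
  rw [← Real.exp_add, Real.exp_le_exp]
  nlinarith

/-- The tracking error of the homogeneous closed loop solves a delayed equation whose disturbance
differs from `v` by an exponentially decaying term. -/
theorem exists_tracking_disturbance (hG : LeaderRooted G) (hϵ : 0 < ϵ)
    (hτu : InputDelays τbar τhat τu) (hτc : CommDelays G τcbar τc) {n p : ℕ}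
    {A : Matrix (Fin n) (Fin n) ℝ} (hA : NoUnstableEigenvalue A) (B : Matrix (Fin n) (Fin p) ℝ)
    (K : Matrix (Fin p) (Fin n) ℝ) :
    ∃ C κ : ℝ, 0 ≤ C ∧ 0 < κ ∧
      ∀ (v : Fin N → ℝ → E n) (x₀ : ℝ → E n) (x ξ : Fin N → ℝ → E n) (u : Fin N → ℝ → E p)
        (D : ℝ), HomClosedLoop G ϵ τu τc A B K v x₀ x ξ u →
        InitialDataBound τbar τcbar x₀ x u D → ∀ i, 0 ≤ D ∧ ‖x i 0 - x₀ 0‖ ≤ 2 * D ∧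
          ∃ w : ℝ → E n, IsPrimitive (fun t => x i t - x₀ t) (fun t => clm A (x i t - x₀ t)
              + clm (B * K) (x i (max (t - τu i t) 0) - x₀ (max (t - τu i t) 0)) + w t) ∧
            ∀ t, 0 ≤ t → ‖w t‖ ≤ ‖v i t‖ + C * D * Real.exp (-κ * t) := by
  obtain ⟨c, κ, hc, hκ, hobs⟩ := exists_observer_error_bound hG hϵ hτc hA
  refine ⟨(‖clm (B * K)‖ * c + (‖clm B‖ + ‖clm (B * K)‖ * 2)) * Real.exp (κ * τbar), κ,
    by positivity, hκ, ?_⟩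
  intro v x₀ x ξ u D hloop hinit i
  have hD : 0 ≤ D := (norm_nonneg _).trans (hinit.state i)
  have hx₀ : ‖x₀ 0‖ ≤ D := hinit.leader 0 ⟨by linarith [hτc.bar_nonneg hG i], le_rfl⟩
  have hz0 : ‖x i 0 - x₀ 0‖ ≤ 2 * D := (norm_sub_le _ _).trans (by linarith [hinit.state i])
  -- `w` is whatever is left of the error equation once the feedback on the constantly extended
  -- error has been split off.
  refine ⟨hD, hz0, fun t => clm B (u i (t - τu i t)) + v i t
    - clm (B * K) (x i (max (t - τu i t) 0) - x₀ (max (t - τu i t) 0)), ?_, fun t ht => ?_⟩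
  · refine ((hloop.follower i).isPrimitive.sub hloop.leader.isPrimitive).congr_right fun t _ => ?_
    simp only [← clm_apply, map_sub]
    abel
  · beta_reduce
    have hθ := hτu.le_bar i t ht
    rcases le_or_gt 0 (t - τu i t) with h0 | h0
    · have hu := hloop.input i _ h0
      have he := hobs x₀ ξ D hloop.leader hloop.observer_init hloop.observer hinit.leader hD i
        (t - τu i t) h0
      rw [max_eq_left h0, hu, ← clm_apply, ← clm_mul_apply]
      have hw : clm (B * K) (x i (t - τu i t) - ξ i (t - τu i t)) + v i t
          - clm (B * K) (x i (t - τu i t) - x₀ (t - τu i t))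
          = v i t - clm (B * K) (ξ i (t - τu i t) - x₀ (t - τu i t)) := by
        simp only [map_sub]
        abel
      rw [hw]
      refine (norm_sub_le _ _).trans (add_le_add_right ?_ _)
      refine (norm_clm_apply_le (B * K) he).trans ?_
      calc ‖clm (B * K)‖ * (c * D * Real.exp (-κ * (t - τu i t)))
          ≤ ‖clm (B * K)‖ * (c * D * (Real.exp (κ * τbar) * Real.exp (-κ * t))) := by
            gcongr
            exact exp_neg_mul_sub_le hκ.le hθ
        _ = ‖clm (B * K)‖ * c * Real.exp (κ * τbar) * D * Real.exp (-κ * t) := by ring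
        _ ≤ _ := by
            gcongr
            exact le_add_of_nonneg_right (by positivity)
    -- An input from before time `0` can act only while `t < τbar`, so a constant multiple of `D`
    -- counts as exponentially decaying, at the price of the factor `e^{κ τbar}`.
    · have hu := hinit.input i (t - τu i t) ⟨by linarith, h0⟩
      rw [max_eq_right h0.le]
      have h1 : ‖clm B (u i (t - τu i t)) + v i t - clm (B * K) (x i 0 - x₀ 0)‖
          ≤ ‖v i t‖ + (‖clm B‖ * D + ‖clm (B * K)‖ * (2 * D)) := by
        refine (norm_sub_le _ _).trans ?_
        have h2 := norm_add_le (clm B (u i (t - τu i t))) (v i t)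
        have h3 := norm_clm_apply_le B hu
        have h4 := norm_clm_apply_le (B * K) hz0
        linarith
      refine h1.trans (add_le_add_right ?_ _)
      refine (le_mul_exp_mul_exp (τbar := τbar) (κ := κ) (t := t) (by positivity) hκ.le
        (by linarith)).trans ?_
      have h5 : 0 ≤ ‖clm (B * K)‖ * c * Real.exp (κ * τbar) * D * Real.exp (-κ * t) := by
        positivity
      linarith

/-- The regulation error of a heterogeneous agent solves a delayed equation with a bounded
disturbance. -/
theorem exists_regulation_disturbance (hG : LeaderRooted G) (hϵ : 0 < ϵ)
    (hτu : InputDelays τbar τhat τu) (hτc : CommDelays G τcbar τc) {n : ℕ}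
    {nn pp : Fin N → ℕ} {A₀ : Matrix (Fin n) (Fin n) ℝ} (hA₀ : MarginallyStable A₀)
    {A : ∀ i, Matrix (Fin (nn i)) (Fin (nn i)) ℝ} {B : ∀ i, Matrix (Fin (nn i)) (Fin (pp i)) ℝ}
    {X : ∀ i, Matrix (Fin (nn i)) (Fin n) ℝ} {U : ∀ i, Matrix (Fin (pp i)) (Fin n) ℝ}
    (hX : ∀ i, X i * A₀ = A i * X i + B i * U i)
    (K₁ : ∀ i, Matrix (Fin (pp i)) (Fin (nn i)) ℝ) (K₂ : ∀ i, Matrix (Fin (pp i)) (Fin n) ℝ)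
    (i : Fin N) :
    ∃ C κ : ℝ, 0 ≤ C ∧ 0 < κ ∧
      ∀ (v : ∀ i, ℝ → E (nn i)) (x₀ : ℝ → E n) (x : ∀ i, ℝ → E (nn i)) (ξ : Fin N → ℝ → E n)
        (u : ∀ i, ℝ → E (pp i)) (D : ℝ), HetClosedLoop G ϵ τu τc A₀ A B K₁ K₂ v x₀ x ξ u →
        InitialDataBound τbar τcbar x₀ x u D → 0 ≤ D ∧ ‖x i 0 - clm (X i) (x₀ 0)‖ ≤ C * D ∧
          ∃ w : ℝ → E (nn i), IsPrimitive (fun t => x i t - clm (X i) (x₀ t))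
              (fun t => clm (A i) (x i t - clm (X i) (x₀ t))
                + clm (B i * K₁ i) (x i (max (t - τu i t) 0)
                  - clm (X i) (x₀ (max (t - τu i t) 0))) + w t) ∧
            (∀ t, 0 ≤ t → ‖w t‖ ≤ ‖v i t‖ + C * D) ∧
            (K₂ i = K₁ i * X i - U i → ∀ t, 0 ≤ t → τbar ≤ t → ‖w t‖ ≤ ‖v i t‖
              + ‖clm (B i * U i) (x₀ t - x₀ (t - τu i t))‖ + C * D * Real.exp (-κ * t)) := by
  obtain ⟨c, κ, hc, hκ, hobs⟩ := exists_observer_error_bound hG hϵ hτc hA₀.noUnstableEigenvalue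
  obtain ⟨k, hk, hgrow⟩ := hA₀.exists_norm_exp_le
  have hτbar : 0 ≤ τbar := (hτu.nonneg i 0 le_rfl).trans (hτu.le_bar i 0 le_rfl)
  obtain ⟨a₁, ha₁⟩ : ∃ a, ‖clm (B i * U i)‖ = a := ⟨_, rfl⟩
  obtain ⟨a₂, ha₂⟩ : ∃ a, ‖clm (B i * (K₁ i * X i - K₂ i))‖ = a := ⟨_, rfl⟩
  obtain ⟨a₃, ha₃⟩ : ∃ a, ‖clm (B i * K₂ i)‖ = a := ⟨_, rfl⟩
  obtain ⟨a₄, ha₄⟩ : ∃ a, ‖clm (B i * K₁ i)‖ * (1 + ‖clm (X i)‖) = a := ⟨_, rfl⟩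
  have p₁ : 0 ≤ a₁ := ha₁ ▸ norm_nonneg _
  have p₂ : 0 ≤ a₂ := ha₂ ▸ norm_nonneg _
  have p₃ : 0 ≤ a₃ := ha₃ ▸ norm_nonneg _
  have p₄ : 0 ≤ a₄ := by rw [← ha₄]; positivity
  have q₁ : 0 ≤ a₁ * k := by positivity
  have q₂ : 0 ≤ a₂ * k := by positivity
  have q₃ : 0 ≤ a₃ * c := by positivity
  have q₃' : 0 ≤ a₃ * c * Real.exp (κ * τbar) := by positivity
  have qB : 0 ≤ ‖clm (B i)‖ := norm_nonneg _
  have qX : 0 ≤ ‖clm (X i)‖ := norm_nonneg _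
  -- The sum of all constants that occur; each estimate below keeps some of its nonnegative terms.
  obtain ⟨C, hC⟩ : ∃ C, 1 + ‖clm (X i)‖ + a₁ * k + a₂ * k + a₃ * c
    + a₃ * c * Real.exp (κ * τbar) + ‖clm (B i)‖ + a₄ = C := ⟨_, rfl⟩
  have hC0 : 0 ≤ C := by linarith
  refine ⟨C, κ, hC0, hκ, ?_⟩
  intro v x₀ x ξ u D hloop hinit
  have hD : 0 ≤ D := (norm_nonneg _).trans (hinit.state i)
  have hx₀ : ‖x₀ 0‖ ≤ D := hinit.leader 0 ⟨by linarith [hτc.bar_nonneg hG i], le_rfl⟩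
  have hlead : ∀ t, 0 ≤ t → ‖x₀ t‖ ≤ k * D := by
    intro t ht
    rw [IsPrimitive.eq_exp_smul (clm A₀) hloop.leader ht]
    exact (ContinuousLinearMap.le_opNorm _ _).trans
      (mul_le_mul (hgrow t ht) hx₀ (norm_nonneg _) hk)
  have hz0 : ‖x i 0 - clm (X i) (x₀ 0)‖ ≤ (1 + ‖clm (X i)‖) * D := by
    refine (norm_sub_le _ _).trans ?_
    have h1 := hinit.state i
    have h2 := norm_clm_apply_le (X i) hx₀
    linarith
  have herr : ∀ t, 0 ≤ t → ‖ξ i t - x₀ t‖ ≤ c * D * Real.exp (-κ * t) :=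
    hobs x₀ ξ D hloop.leader hloop.observer_init hloop.observer hinit.leader hD i
  -- Once the delayed time is nonnegative, writing `ξ = x₀ + (ξ - x₀)` isolates the decaying
  -- observer error; the rest involves only `v` and the leader.
  have hlate : ∀ t, 0 ≤ t - τu i t →
      clm (B i) (u i (t - τu i t)) + v i t - clm (B i * U i) (x₀ t)
        - clm (B i * K₁ i) (x i (max (t - τu i t) 0) - clm (X i) (x₀ (max (t - τu i t) 0)))
      = v i t - clm (B i * U i) (x₀ t) + clm (B i * (K₁ i * X i - K₂ i)) (x₀ (t - τu i t))
        - clm (B i * K₂ i) (ξ i (t - τu i t) - x₀ (t - τu i t)) := by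
    intro t h0
    rw [max_eq_left h0, hloop.input i _ h0]
    simp only [← clm_apply, map_sub, clm_mul_apply, Matrix.mul_sub]
    have hsub : ∀ (T T' : Matrix (Fin (nn i)) (Fin n) ℝ) (y : E n),
        clm (T - T') y = clm T y - clm T' y := by
      intro T T' y
      simp [clm_apply]
    simp only [hsub, clm_mul_apply]
    abel
  refine ⟨hD, hz0.trans (mul_le_mul_of_nonneg_right (by linarith) hD),
    fun t => clm (B i) (u i (t - τu i t)) + v i t - clm (B i * U i) (x₀ t)
    - clm (B i * K₁ i) (x i (max (t - τu i t) 0) - clm (X i) (x₀ (max (t - τu i t) 0))), ?_,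
    fun t ht => ?_, fun hK₂ t ht htb => ?_⟩
  · have hprim := (hloop.follower i).isPrimitive.sub (hloop.leader.isPrimitive.map (clm (X i)))
    refine hprim.congr_right fun t _ => ?_
    have h1 : clm (X i) (clm A₀ (x₀ t)) = clm (A i) (clm (X i) (x₀ t))
        + clm (B i * U i) (x₀ t) := by
      rw [← clm_mul_apply, hX i, ← clm_mul_apply]
      simp [clm_apply]
    simp only [← clm_apply, map_sub, h1]
    abel
  · beta_reduce
    have hb1 := norm_clm_apply_le (B i * U i) (hlead t ht)
    rw [ha₁] at hb1
    rcases le_or_gt 0 (t - τu i t) with h0 | h0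
    · rw [hlate t h0]
      have hb2 := norm_clm_apply_le (B i * (K₁ i * X i - K₂ i)) (hlead _ h0)
      rw [ha₂] at hb2
      have h1 : ‖ξ i (t - τu i t) - x₀ (t - τu i t)‖ ≤ c * D :=
        (herr _ h0).trans (mul_le_of_le_one_right (by positivity)
          (Real.exp_le_one_iff.2 (by nlinarith)))
      have hb3 := norm_clm_apply_le (B i * K₂ i) h1
      rw [ha₃] at hb3
      have h2 : ‖v i t - clm (B i * U i) (x₀ t)
          + clm (B i * (K₁ i * X i - K₂ i)) (x₀ (t - τu i t))
          - clm (B i * K₂ i) (ξ i (t - τu i t) - x₀ (t - τu i t))‖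
          ≤ ‖v i t‖ + (a₁ * k + a₂ * k + a₃ * c) * D := by
        refine (norm_sub_le _ _).trans ?_
        have h3 := norm_add_le (v i t - clm (B i * U i) (x₀ t))
          (clm (B i * (K₁ i * X i - K₂ i)) (x₀ (t - τu i t)))
        have h4 := norm_sub_le (v i t) (clm (B i * U i) (x₀ t))
        linarith
      refine h2.trans (add_le_add_right (mul_le_mul_of_nonneg_right ?_ hD) _)
      linarith
    · have hθ := hτu.le_bar i t ht
      have hu := hinit.input i (t - τu i t) ⟨by linarith, h0⟩
      rw [max_eq_right h0.le]
      have hb2 := norm_clm_apply_le (B i) hu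
      have hb3 := norm_clm_apply_le (B i * K₁ i) hz0
      have h2 : ‖clm (B i) (u i (t - τu i t)) + v i t - clm (B i * U i) (x₀ t)
          - clm (B i * K₁ i) (x i 0 - clm (X i) (x₀ 0))‖
          ≤ ‖v i t‖ + (‖clm (B i)‖ + a₁ * k + a₄) * D := by
        refine (norm_sub_le _ _).trans ?_
        have h3 := norm_sub_le (clm (B i) (u i (t - τu i t)) + v i t) (clm (B i * U i) (x₀ t))
        have h4 := norm_add_le (clm (B i) (u i (t - τu i t))) (v i t)
        rw [← ha₄]
        linarith
      refine h2.trans (add_le_add_right (mul_le_mul_of_nonneg_right ?_ hD) _)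
      linarith
  · have h0 : 0 ≤ t - τu i t := by linarith [hτu.le_bar i t ht]
    -- For this sign of the gain the delayed leader term has coefficient `B U`, so it cancels the
    -- undelayed one up to `x₀(t) - x₀(t - τ)`.
    have hKU : K₁ i * X i - K₂ i = U i := by rw [hK₂]; abel
    beta_reduce
    rw [hlate t h0, hKU]
    have h1 : v i t - clm (B i * U i) (x₀ t) + clm (B i * U i) (x₀ (t - τu i t))
        = v i t - clm (B i * U i) (x₀ t - x₀ (t - τu i t)) := by
      rw [map_sub]
      abel
    rw [h1]
    have h2 : ‖ξ i (t - τu i t) - x₀ (t - τu i t)‖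
        ≤ c * D * (Real.exp (κ * τbar) * Real.exp (-κ * t)) :=
      (herr _ h0).trans (mul_le_mul_of_nonneg_left (exp_neg_mul_sub_le hκ.le (hτu.le_bar i t ht))
        (by positivity))
    have hb3 := norm_clm_apply_le (B i * K₂ i) h2
    rw [ha₃] at hb3
    have h3 := norm_sub_le (v i t - clm (B i * U i) (x₀ t - x₀ (t - τu i t)))
      (clm (B i * K₂ i) (ξ i (t - τu i t) - x₀ (t - τu i t)))
    have h4 := norm_sub_le (v i t) (clm (B i * U i) (x₀ t - x₀ (t - τu i t)))
    have h5 : a₃ * c * Real.exp (κ * τbar) * D * Real.exp (-κ * t)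
        ≤ C * D * Real.exp (-κ * t) := by
      gcongr
      linarith
    linarith

/-- A disturbance that is eventually within an exponentially decaying distance of a bound. -/
theorem exists_forall_le_add_of_exp {n : ℕ} {w : ℝ → E n} {a b κ T : ℝ} (hκ : 0 < κ)
    (h : ∀ᵐ t ∂(volume.restrict (Set.Ici T)), ‖w t‖ ≤ a + b * Real.exp (-κ * t))
    {η : ℝ} (hη : 0 < η) :
    ∃ T', ∀ᵐ t ∂(volume.restrict (Set.Ici T')), ‖w t‖ ≤ a + η := by
  have hlim : Tendsto (fun t : ℝ => b * Real.exp (-κ * t)) atTop (𝓝 0) := by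
    have h1 : Tendsto (fun t : ℝ => κ * t) atTop atTop := tendsto_id.const_mul_atTop hκ
    have h2 := (Real.tendsto_exp_neg_atTop_nhds_zero.comp h1).const_mul b
    rw [mul_zero] at h2
    refine h2.congr fun t => ?_
    simp [Function.comp]
  obtain ⟨T₁, hT₁⟩ := eventually_atTop.1 (hlim.eventually_lt_const hη)
  refine ⟨max T T₁, ?_⟩
  filter_upwards [ae_restrict_of_ae_restrict_of_subset
    (Set.Ici_subset_Ici.2 (le_max_left T T₁)) h, ae_restrict_mem measurableSet_Ici] with t ht ht'
  have := hT₁ t ((le_max_right T T₁).trans ht')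
  linarith

end ClosedLoop

end DelayMAS

end

/-! ### Assembly of the theorem. -/

open DelayMAS in
theorem lemma2 {N : ℕ} (G : Digraph (Fin (N + 1))) (hG : LeaderRooted G)
    (ϵ : ℝ) (hϵ : 0 < ϵ)
    (τbar τhat δ γ ε : ℝ) (hτbar : 0 ≤ τbar) (hτhat : 0 ≤ τhat) (hδ : 0 < δ) (hγ : 0 < γ)
    (τu : Fin N → ℝ → ℝ) (hτu : InputDelays τbar τhat τu)
    (τcbar : ℝ) (τc : Fin N → Fin (N + 1) → ℝ → ℝ) (hτc : CommDelays G τcbar τc) :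
    -- homogeneous agents
    (∀ (n p : ℕ) (A : Matrix (Fin n) (Fin n) ℝ) (B : Matrix (Fin n) (Fin p) ℝ)
        (P Q R S S₁₂ M : Matrix (Fin n) (Fin n) ℝ) (Y K : Matrix (Fin p) (Fin n) ℝ),
      NoUnstableEigenvalue A →
      LMISolution A B τbar τhat δ γ ε P Q R S S₁₂ M Y →
      K = Y * M⁻¹ →
      -- exponential stability of the tracking error without disturbance
      (∃ c κ : ℝ, 0 < c ∧ 0 < κ ∧
        ∀ (v : Fin N → ℝ → E n) (x₀ : ℝ → E n) (x ξ : Fin N → ℝ → E n) (u : Fin N → ℝ → E p)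
          (D : ℝ), HomClosedLoop G ϵ τu τc A B K v x₀ x ξ u →
          InitialDataBound τbar τcbar x₀ x u D →
          ∀ i, (∀ᵐ t ∂(volume.restrict (Set.Ici (0 : ℝ))), v i t = 0) →
            ∀ t : ℝ, 0 ≤ t → ‖x i t - x₀ t‖ ≤ c * D * Real.exp (-κ * t)) ∧
      -- boundedness of the tracking error under bounded disturbances
      (∃ c : ℝ, 0 < c ∧
        ∀ (v : Fin N → ℝ → E n) (x₀ : ℝ → E n) (x ξ : Fin N → ℝ → E n) (u : Fin N → ℝ → E p)
          (D : ℝ), HomClosedLoop G ϵ τu τc A B K v x₀ x ξ u →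
          InitialDataBound τbar τcbar x₀ x u D →
          ∀ (i : Fin N) (Δ : ℝ), EssBoundedBy (v i) Δ →
            ∀ t : ℝ, 0 ≤ t → ‖x i t - x₀ t‖ ≤ c * (D + Δ)) ∧
      -- ultimate bound
      (∀ (v : Fin N → ℝ → E n) (x₀ : ℝ → E n) (x ξ : Fin N → ℝ → E n) (u : Fin N → ℝ → E p)
          (D : ℝ), HomClosedLoop G ϵ τu τc A B K v x₀ x ξ u →
          InitialDataBound τbar τcbar x₀ x u D →
          ∀ (i : Fin N) (Δ : ℝ), EssBoundedBy (v i) Δ →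
            ∀ η : ℝ, 0 < η → ∀ᶠ t in atTop,
              ‖x i t - x₀ t‖ ^ 2 ≤ γ / (2 * δ * lambdaMin (unbar P M)) * Δ ^ 2 + η)) ∧
    -- heterogeneous agents
    (∀ (n q : ℕ) (nn pp : Fin N → ℕ)
        (A₀ : Matrix (Fin n) (Fin n) ℝ) (C₀ : Matrix (Fin q) (Fin n) ℝ)
        (A : ∀ i, Matrix (Fin (nn i)) (Fin (nn i)) ℝ) (B : ∀ i, Matrix (Fin (nn i)) (Fin (pp i)) ℝ)
        (C : ∀ i, Matrix (Fin q) (Fin (nn i)) ℝ)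
        (X : ∀ i, Matrix (Fin (nn i)) (Fin n) ℝ) (U : ∀ i, Matrix (Fin (pp i)) (Fin n) ℝ)
        (P Q R S S₁₂ M : ∀ i, Matrix (Fin (nn i)) (Fin (nn i)) ℝ)
        (Y K₁ : ∀ i, Matrix (Fin (pp i)) (Fin (nn i)) ℝ),
      MarginallyStable A₀ →
      (∀ i, X i * A₀ = A i * X i + B i * U i ∧ C₀ = C i * X i) →
      (∀ i, LMISolution (A i) (B i) τbar τhat δ γ ε
        (P i) (Q i) (R i) (S i) (S₁₂ i) (M i) (Y i)) →
      (∀ i, K₁ i = Y i * (M i)⁻¹) →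
      -- boundedness of the output consensus error, for either sign of the observer gain
      (∀ K₂ : ∀ i, Matrix (Fin (pp i)) (Fin n) ℝ,
        ((∀ i, K₂ i = U i - K₁ i * X i) ∨ (∀ i, K₂ i = K₁ i * X i - U i)) →
        ∃ c : ℝ, 0 < c ∧
          ∀ (v : ∀ i, ℝ → E (nn i)) (x₀ : ℝ → E n) (x : ∀ i, ℝ → E (nn i)) (ξ : Fin N → ℝ → E n)
            (u : ∀ i, ℝ → E (pp i)) (D : ℝ), HetClosedLoop G ϵ τu τc A₀ A B K₁ K₂ v x₀ x ξ u →
            InitialDataBound τbar τcbar x₀ x u D →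
            ∀ (i : Fin N) (Δ : ℝ), EssBoundedBy (v i) Δ →
              ∀ t : ℝ, 0 ≤ t →
                ‖(C i).toEuclideanLin (x i t) - C₀.toEuclideanLin (x₀ t)‖ ≤ c * (D + Δ)) ∧
      -- ultimate bound
      (∀ K₂ : ∀ i, Matrix (Fin (pp i)) (Fin n) ℝ, (∀ i, K₂ i = K₁ i * X i - U i) →
          ∀ (v : ∀ i, ℝ → E (nn i)) (x₀ : ℝ → E n) (x : ∀ i, ℝ → E (nn i)) (ξ : Fin N → ℝ → E n)
            (u : ∀ i, ℝ → E (pp i)) (D : ℝ), HetClosedLoop G ϵ τu τc A₀ A B K₁ K₂ v x₀ x ξ u →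
            InitialDataBound τbar τcbar x₀ x u D →
            ∀ (i : Fin N) (Δ β : ℝ), EssBoundedBy (v i) Δ →
              (∀ᶠ t in atTop, ‖(B i * U i).toEuclideanLin (x₀ t - x₀ (t - τu i t))‖ ≤ β) →
              ∀ η : ℝ, 0 < η → ∀ᶠ t in atTop,
                ‖(C i).toEuclideanLin (x i t) - C₀.toEuclideanLin (x₀ t)‖ ^ 2 ≤
                  γ * opNorm (C i) ^ 2 / (2 * δ * lambdaMin (unbar (P i) (M i))) * (Δ + β) ^ 2
                    + η)) := by
  refine ⟨?_, ?_⟩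
  · intro n p A B P Q R S S₁₂ M Y K hA hL hK
    obtain ⟨c, hc, hstate⟩ := hL.exists_state_bound hK hτbar hδ hγ
    obtain ⟨C, κ, hC, hκ, hdist⟩ := exists_tracking_disturbance hG hϵ hτu hτc hA B K
    -- `(C + 2) D` dominates both the initial error `2 D` and the amplitude `C D` of the
    -- disturbance; adding `1` makes the constants positive, since `c` may be zero.
    refine ⟨⟨c * (C + 2) + 1, min κ δ / 2, by positivity, by positivity, ?_⟩,
      ⟨c * (C + 3) + 1, by positivity, ?_⟩, ?_⟩
    · intro v x₀ x ξ u D hloop hinit i hv t ht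
      obtain ⟨hD, hz0, w, hprim, hw⟩ := hdist v x₀ x ξ u D hloop hinit i
      have hwe : ∀ᵐ t ∂(volume.restrict (Set.Ici (0 : ℝ))),
          ‖w t‖ ≤ (C + 2) * D * Real.exp (-κ * t) := by
        filter_upwards [hv, ae_restrict_mem measurableSet_Ici] with r hr hr0
        have h1 := hw r hr0
        rw [hr, norm_zero, zero_add] at h1
        refine h1.trans ?_
        gcongr
        linarith
      have hbdd : ∃ a, ∀ᵐ t ∂(volume.restrict (Set.Ici (0 : ℝ))), ‖w t‖ ≤ a := by
        refine ⟨(C + 2) * D, ?_⟩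
        filter_upwards [hwe, ae_restrict_mem measurableSet_Ici] with r hr hr0
        have hr0 : (0 : ℝ) ≤ r := hr0
        exact hr.trans (mul_le_of_le_one_right (by positivity)
          (Real.exp_le_one_iff.2 (by nlinarith)))
      have h1 := (hstate (τu i) (hτu.isInputDelay i) _ w ⟨hprim, hbdd⟩).2 ((C + 2) * D) κ hκ
        (by positivity) (hz0.trans (by gcongr; linarith)) hwe t ht
      refine h1.trans ?_
      rw [← mul_assoc]
      gcongr
      linarith
    · intro v x₀ x ξ u D hloop hinit i Δ hv t ht
      obtain ⟨hD, hz0, w, hprim, hw⟩ := hdist v x₀ x ξ u D hloop hinit i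
      have hΔ := hv.nonneg
      have hwe : ∀ᵐ t ∂(volume.restrict (Set.Ici (0 : ℝ))), ‖w t‖ ≤ Δ + C * D := by
        filter_upwards [hv.2, ae_restrict_mem measurableSet_Ici] with r hr hr0
        have hr0 : (0 : ℝ) ≤ r := hr0
        have h1 : C * D * Real.exp (-κ * r) ≤ C * D := mul_le_of_le_one_right (by positivity)
          (Real.exp_le_one_iff.2 (by nlinarith))
        linarith [hw r hr0]
      have h1 := (hstate (τu i) (hτu.isInputDelay i) _ w ⟨hprim, _, hwe⟩).1 (Δ + C * D)
        (by positivity) hwe t ht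
      refine h1.trans ?_
      have h2 : ‖x i 0 - x₀ 0‖ + (Δ + C * D) ≤ (C + 3) * (D + Δ) := by
        have : 0 ≤ C * Δ := by positivity
        linarith
      have h3 := mul_le_mul_of_nonneg_left h2 hc
      linarith
    · intro v x₀ x ξ u D hloop hinit i Δ hv η hη
      obtain ⟨hD, hz0, w, hprim, hw⟩ := hdist v x₀ x ξ u D hloop hinit i
      have hwe : ∀ᵐ t ∂(volume.restrict (Set.Ici (0 : ℝ))),
          ‖w t‖ ≤ Δ + C * D * Real.exp (-κ * t) := by
        filter_upwards [hv.2, ae_restrict_mem measurableSet_Ici] with r hr hr0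
        linarith [hw r hr0]
      have hbdd : ∃ a, ∀ᵐ t ∂(volume.restrict (Set.Ici (0 : ℝ))), ‖w t‖ ≤ a := by
        refine ⟨Δ + C * D, ?_⟩
        filter_upwards [hwe, ae_restrict_mem measurableSet_Ici] with r hr hr0
        have hr0 : (0 : ℝ) ≤ r := hr0
        have h1 : C * D * Real.exp (-κ * r) ≤ C * D := mul_le_of_le_one_right (by positivity)
          (Real.exp_le_one_iff.2 (by nlinarith))
        linarith
      exact hL.eventually_norm_sq_le hK hτbar hδ hγ (hτu.isInputDelay i) ⟨hprim, hbdd⟩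
        (fun η hη => exists_forall_le_add_of_exp hκ hwe hη) hη
  · intro n q nn pp A₀ C₀ A B C X U P Q R S S₁₂ M Y K₁ hA₀ hX hL hK
    -- The regulator equation `C₀ = C_i X_i` makes the output error the image under `C_i` of the
    -- regulation error.
    have hout : ∀ (i : Fin N) (y : E (nn i)) (y₀ : E n),
        (C i).toEuclideanLin y - C₀.toEuclideanLin y₀ = clm (C i) (y - clm (X i) y₀) := by
      intro i y y₀
      rw [(hX i).2, toEuclideanLin_mul_apply, ← map_sub]
      rfl
    refine ⟨fun K₂ _ => ?_, fun K₂ hK₂ => ?_⟩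
    · choose c hc hstate using fun i => (hL i).exists_state_bound (hK i) hτbar hδ hγ
      choose k κ hk hκ hdist using fun i =>
        exists_regulation_disturbance hG hϵ hτu hτc hA₀ (fun i => (hX i).1) K₁ K₂ i
      let b : Fin N → ℝ := fun i => ‖clm (C i)‖ * (c i * (2 * k i + 1))
      have hb : ∀ i, 0 ≤ b i := fun i => by
        have := hc i
        have := hk i
        positivity
      have hbs : 0 ≤ ∑ i, b i := Finset.sum_nonneg fun i _ => hb i
      -- Summing over the agents gives one constant valid for all of them.
      refine ⟨∑ i, b i + 1, by positivity, ?_⟩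
      intro v x₀ x ξ u D hloop hinit i Δ hv t ht
      obtain ⟨hD, hz0, w, hprim, hw, -⟩ := hdist i v x₀ x ξ u D hloop hinit
      have hΔ := hv.nonneg
      have hki := hk i
      have hci := hc i
      have hwe : ∀ᵐ t ∂(volume.restrict (Set.Ici (0 : ℝ))), ‖w t‖ ≤ Δ + k i * D := by
        filter_upwards [hv.2, ae_restrict_mem measurableSet_Ici] with r hr hr0
        linarith [hw r hr0]
      have h1 := (hstate i (τu i) (hτu.isInputDelay i) _ w ⟨hprim, _, hwe⟩).1 (Δ + k i * D)
        (by positivity) hwe t ht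
      rw [hout]
      have h2 : ‖x i 0 - clm (X i) (x₀ 0)‖ + (Δ + k i * D) ≤ (2 * k i + 1) * (D + Δ) := by
        have : 0 ≤ k i * Δ := by positivity
        linarith
      calc ‖clm (C i) (x i t - clm (X i) (x₀ t))‖
          ≤ ‖clm (C i)‖ * (c i * ((2 * k i + 1) * (D + Δ))) :=
            norm_clm_apply_le _ (h1.trans (mul_le_mul_of_nonneg_left h2 hci))
        _ = b i * (D + Δ) := by ring
        _ ≤ (∑ i, b i + 1) * (D + Δ) := by
            refine mul_le_mul_of_nonneg_right ?_ (by positivity)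
            have := Finset.single_le_sum (fun i _ => hb i) (Finset.mem_univ i)
            linarith
    · intro v x₀ x ξ u D hloop hinit i Δ β hv hβ η hη
      obtain ⟨k, κ, hk, hκ, hdist⟩ :=
        exists_regulation_disturbance hG hϵ hτu hτc hA₀ (fun i => (hX i).1) K₁ K₂ i
      obtain ⟨hD, hz0, w, hprim, hw, hlate⟩ := hdist v x₀ x ξ u D hloop hinit
      have hbdd : ∃ a, ∀ᵐ t ∂(volume.restrict (Set.Ici (0 : ℝ))), ‖w t‖ ≤ a := by
        refine ⟨Δ + k * D, ?_⟩
        filter_upwards [hv.2, ae_restrict_mem measurableSet_Ici] with r hr hr0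
        linarith [hw r hr0]
      obtain ⟨T, hT⟩ := eventually_atTop.1 hβ
      -- After `T` the bound `β` holds, and after `τbar` the delayed input no longer comes from the
      -- initial data.
      have hwe : ∀ᵐ t ∂(volume.restrict (Set.Ici (max (max T τbar) 0))),
          ‖w t‖ ≤ (Δ + β) + k * D * Real.exp (-κ * t) := by
        filter_upwards [ae_restrict_of_ae_restrict_of_subset
          (Set.Ici_subset_Ici.2 (le_max_right (max T τbar) 0)) hv.2,
          ae_restrict_mem measurableSet_Ici] with r hr hr0
        have hr0 : max (max T τbar) 0 ≤ r := hr0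
        have h0 : 0 ≤ r := (le_max_right _ _).trans hr0
        have h1 : max T τbar ≤ r := (le_max_left _ _).trans hr0
        have h2 := hT r ((le_max_left _ _).trans h1)
        have h3 := hlate (hK₂ i) r h0 ((le_max_right _ _).trans h1)
        rw [← clm_apply] at h2
        linarith
      -- The state estimate is used with tolerance `η / (‖C_i‖² + 1)`, so that multiplication by
      -- `‖C_i‖²` keeps it below `η`, also when `C_i = 0`.
      have hpos : 0 < ‖clm (C i)‖ ^ 2 + 1 := by positivity
      filter_upwards [(hL i).eventually_norm_sq_le (hK i) hτbar hδ hγ (hτu.isInputDelay i)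
        ⟨hprim, hbdd⟩ (fun η hη => exists_forall_le_add_of_exp hκ hwe hη) (div_pos hη hpos)]
        with t ht
      rw [hout]
      have h1 := norm_clm_apply_le (C i) (le_refl ‖x i t - clm (X i) (x₀ t)‖)
      have h2 : ‖clm (C i)‖ ^ 2 * (η / (‖clm (C i)‖ ^ 2 + 1)) ≤ η := by
        rw [mul_div_assoc', div_le_iff₀ hpos]
        linarith
      calc ‖clm (C i) (x i t - clm (X i) (x₀ t))‖ ^ 2
          ≤ (‖clm (C i)‖ * ‖x i t - clm (X i) (x₀ t)‖) ^ 2 := by gcongr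
        _ = ‖clm (C i)‖ ^ 2 * ‖x i t - clm (X i) (x₀ t)‖ ^ 2 := by ring
        _ ≤ ‖clm (C i)‖ ^ 2 * (γ / (2 * δ * lambdaMin (unbar (P i) (M i))) * (Δ + β) ^ 2
              + η / (‖clm (C i)‖ ^ 2 + 1)) := by gcongr
        _ = γ * ‖clm (C i)‖ ^ 2 / (2 * δ * lambdaMin (unbar (P i) (M i))) * (Δ + β) ^ 2
              + ‖clm (C i)‖ ^ 2 * (η / (‖clm (C i)‖ ^ 2 + 1)) := by ring
        _ ≤ _ := add_le_add_right h2 _
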